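/- **Setting.** Let $\mu_0$ be a probability law on $\mathbb R^p\times\mathbb R$ and $(X,Y)\sim\mu_0$ with $X\in[-c_0,c_0]^p$ and $|Y|\le M$ almost surely ($c_0,M>0$; e.g. $M=c_0$), and let $\mu_u$ be a probability law on $[0,1]^q$. For $B>0$ let $\mathcal H_{\mathtt{nn}}$ be the class of functions $g(x,u)=\mathrm{Tc}_M\big(T_{L+1}\circ\bar\sigma\circ T_L\circ\cdots\circ\bar\sigma\circ T_1([x,u])\big)$, $x\in\mathbb R^p$, $u\in\mathbb R^q$, where $\bar\sigma$ is the entrywise ReLU, $T_l(z)=W_lz+b_l$ are affine maps between layers of widths $(p+q,N,\dots,N,1)$ ($L$ hidden layers), all entries of the $W_l$, $b_l$ are bounded by $B$ in absolute value, and $\mathrm{Tc}_M(z)=\min\{|z|,M\}\,\mathrm{sign}(z)$. Let $k:\mathbb R\times\mathbb R\to\mathbb R$ be a measurable, symmetric, positive definite kernel with reproducing kernel Hilbert space $\mathcal H_k$ and feature map $\phi(y)=k(y,\cdot)$, such that for some $\kappa,L_k>0$ and all $y,y'\in[-M,M]$, $$k(y,y)\le\kappa^2,\qquad \|\phi(y)-\phi(y')\|_{\mathcal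 H_k}^2\le L_k|y-y'|.$$ Put $\mu_g(x)=\mathbb E_{U\sim\mu_u}[\phi(g(x,U))]$, $\mu^\star(x)=\mathbb E[\phi(Y)\mid X=x]$ and $\|\mu_g-\mu^\star\|_2^2=\mathbb E_X\|\mu_g(X)-\mu^\star(X)\|_{\mathcal H_k}^2$. Let $(X_i,Y_i)_{i\le n}$ be i.i.d. from $\mu_0$ and, independently of them, let $(U_{b,i,r})_{b\le m_1,\,i\le n,\,r\le m_2}$ be i.i.d. from $\mu_u$, with $m_1\ge1$, $m_2\ge2$. Define $$\mathsf R_{n,m}^{(k)}(g)=\frac1{m_1}\sum_{b=1}^{m_1}\frac1n\sum_{i=1}^n\Big(\frac{1}{m_2(m_2-1)}\sum_{r\ne s}k\big(g(X_i,U_{b,i,r}),g(X_i,U_{b,i,s})\big)-\frac2{m_2}\sum_{r=1}^{m_2}k\big(g(X_i,U_{b,i,r}),Y_i\big)\Big).$$ Assume $n\ge3$, $L\ge3$, $N\ge p+q+2$, $\log B\le c_1\log n$ and $\log(NL)\le c_1\log n$. For $t>0$ put $$\delta_{n,t}=NL\sqrt{\frac{\log n}{n}}+\sqrt{\frac tn}.$$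 **Theorem.** For all $c_0,M>0$ and $c_1,\rho\in\mathbb R$ there is a constant $C>0$, depending only on $c_0,M,c_1,\rho$, such that in every setting as above with $L_k\le\rho\,\kappa^2$, for every $t>0$ and every $\delta_{\mathtt{opt}}\in\mathbb R$: if $\hat g\in\mathcal H_{\mathtt{nn}}$ is a (random) function with, almost surely, $$\mathsf R_{n,m}^{(k)}(\hat g)\le\inf_{g\in\mathcal H_{\mathtt{nn}}}\mathsf R_{n,m}^{(k)}(g)+\delta_{\mathtt{opt}},$$ then, with probability at least $1-4e^{-t}$, $$\|\mu_{\hat g}-\mu^\star\|_2^2\le C\Big(\inf_{g\in\mathcal H_{\mathtt{nn}}}\|\mu_g-\mu^\star\|_2^2+\kappa^2\delta_{n,t}^2+\kappa^2\frac{\delta_{n,t}}{\sqrt{m_1m_2}}+\delta_{\mathtt{opt}}\Big).$$ -/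

import Mathlib

open MeasureTheory ProbabilityTheory
open scoped Matrix

noncomputable section

/-! ### Stochastic deep ReLU networks -/

/-- The weights and biases of a fully connected network with input dimension `d`, depth `L`
(that is, `L` hidden layers), width `N` and scalar output:
the layer widths are `(d, N, …, N, 1)`, with `N` repeated `L` times (`L ≥ 1`). -/
structure ReLUParams (d L N : ℕ) where
  /-- first affine map `ℝ^d → ℝ^N` -/
  Win : Matrix (Fin N) (Fin d) ℝ
  bin : Fin N → ℝ
  /-- the `L - 1` affine maps `ℝ^N → ℝ^N` between consecutive hidden layers -/
  W : Fin (L - 1) → Matrix (Fin N) (Fin N) ℝ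
  b : Fin (L - 1) → Fin N → ℝ
  /-- last affine map `ℝ^N → ℝ` -/
  Wout : Fin N → ℝ
  bout : ℝ

/-- Entrywise ReLU activation `σ(z) = max {0, z}`. -/
def relu {N : ℕ} (z : Fin N → ℝ) : Fin N → ℝ := fun j => max 0 (z j)

/-- The truncation operator `Tc_M(z) = min {|z|, M} * sign z`. -/
def truncate (M z : ℝ) : ℝ := min |z| M * Real.sign z

namespace ReLUParams

variable {d L N : ℕ}

/-- All weights and biases are bounded by `B` in absolute value. -/
def BoundedBy (θ : ReLUParams d L N) (B : ℝ) : Prop :=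
  (∀ i j, |θ.Win i j| ≤ B) ∧ (∀ i, |θ.bin i| ≤ B) ∧
  (∀ l i j, |θ.W l i j| ≤ B) ∧ (∀ l i, |θ.b l i| ≤ B) ∧
  (∀ j, |θ.Wout j| ≤ B) ∧ |θ.bout| ≤ B

/-- The function `T_{L+1} ∘ σ ∘ T_L ∘ ⋯ ∘ σ ∘ T_1` realized by the network. -/
def eval (θ : ReLUParams d L N) (z : Fin d → ℝ) : ℝ :=
  θ.Wout ⬝ᵥ
      (Fin.foldl (L - 1) (fun h l => relu (θ.W l *ᵥ h + θ.b l)) (relu (θ.Win *ᵥ z + θ.bin)))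
    + θ.bout

end ReLUParams

/-- The class of stochastic deep ReLU networks `g(x, u)` with covariate `x ∈ ℝ^p` and noise
`u ∈ ℝ^q` as joint input, depth `L`, width `N`, truncated at level `M`, with all weights and
biases bounded by `B`. -/
def stochReLU (p q L N : ℕ) (M B : ℝ) : Set ((Fin p → ℝ) → (Fin q → ℝ) → ℝ) :=
  {g | ∃ θ : ReLUParams (p + q) L N, θ.BoundedBy B ∧
    g = fun x u => truncate M (θ.eval (Fin.append x u))}

/-! ### Kernel mean embeddings -/

section Embedding

variable (H : Type*) [NormedAddCommGroup H] [InnerProductSpace ℝ H] [CompleteSpace H]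
  [RKHS ℝ H ℝ ℝ]

/-- The canonical feature map `φ(y) = k(·, y)` of a reproducing kernel Hilbert space `H` of
functions `ℝ → ℝ`. -/
def featureMap (y : ℝ) : H := RKHS.kerFun H y (1 : ℝ)

/-- `H` is the reproducing kernel Hilbert space of `k : ℝ × ℝ → ℝ` (in particular, `k` is then
symmetric and positive definite). -/
def HasKernel (k : ℝ → ℝ → ℝ) : Prop := ∀ y y', RKHS.kernel H y y' (1 : ℝ) = k y y'

/-- The conditional kernel mean embedding `μ_g(x) = E_U[φ(g(x, U))]`, `U ∼ μᵤ`. -/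
def genEmbedding {p q : ℕ} (μᵤ : Measure (Fin q → ℝ)) (g : (Fin p → ℝ) → (Fin q → ℝ) → ℝ)
    (x : Fin p → ℝ) : H :=
  ∫ u, featureMap H (g x u) ∂μᵤ

/-- The target conditional embedding `μ⋆(x) = E[φ(Y) | X = x]`, `(X, Y) ∼ μ₀`: the integral of
`φ` against the regular conditional distribution of `Y` given `X = x`. -/
def targetEmbedding {p : ℕ} (μ₀ : Measure ((Fin p → ℝ) × ℝ)) [IsFiniteMeasure μ₀]
    (x : Fin p → ℝ) : H :=
  ∫ y, featureMap H y ∂(μ₀.condKernel x)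

/-- The squared error `‖μ_g - μ⋆‖₂² = E_X ‖μ_g(X) - μ⋆(X)‖²_H`, with `X` distributed according
to the first marginal of `μ₀`. -/
def embeddingError {p q : ℕ} (μ₀ : Measure ((Fin p → ℝ) × ℝ)) [IsFiniteMeasure μ₀]
    (μᵤ : Measure (Fin q → ℝ)) (g : (Fin p → ℝ) → (Fin q → ℝ) → ℝ) : ℝ :=
  ∫ x, ‖genEmbedding H μᵤ g x - targetEmbedding H μ₀ x‖ ^ 2 ∂μ₀.fst

end Embedding

/-! ### The empirical objective and the sampling scheme -/

/-- The empirical kernel MMD objective of a generator `g`, for data `(x i, y i)` and simulated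
noises `u b i r`. -/
def kernelLoss (k : ℝ → ℝ → ℝ) {p q n m₁ m₂ : ℕ} (x : Fin n → Fin p → ℝ) (y : Fin n → ℝ)
    (u : Fin m₁ → Fin n → Fin m₂ → Fin q → ℝ) (g : (Fin p → ℝ) → (Fin q → ℝ) → ℝ) : ℝ :=
  (1 / (m₁ : ℝ)) * ∑ b, (1 / (n : ℝ)) * ∑ i,
    ((1 / ((m₂ : ℝ) * ((m₂ : ℝ) - 1))) *
        ∑ r, ∑ s ∈ Finset.univ.erase r, k (g (x i) (u b i r)) (g (x i) (u b i s))
      - (2 / (m₂ : ℝ)) * ∑ r, k (g (x i) (u b i r)) (y i))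

/-- The pairs `(X i, Y i)` are i.i.d. with law `μ₀`, the noises `U b i r` are i.i.d. with law `μᵤ`,
and the noises are independent of the data. -/
structure IsSample {Ω : Type*} [MeasurableSpace Ω] (P : Measure Ω) {p q n m₁ m₂ : ℕ}
    (μ₀ : Measure ((Fin p → ℝ) × ℝ)) (μᵤ : Measure (Fin q → ℝ))
    (X : Fin n → Ω → Fin p → ℝ) (Y : Fin n → Ω → ℝ)
    (U : Fin m₁ → Fin n → Fin m₂ → Ω → Fin q → ℝ) : Prop where
  law_data : ∀ i, HasLaw (fun ω => (X i ω, Y i ω)) μ₀ P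
  indep_data : iIndepFun (fun i ω => (X i ω, Y i ω)) P
  law_noise : ∀ b i r, HasLaw (U b i r) μᵤ P
  indep_noise : iIndepFun (fun (j : Fin m₁ × Fin n × Fin m₂) ω => U j.1 j.2.1 j.2.2 ω) P
  indep_data_noise : IndepFun (fun ω i => (X i ω, Y i ω)) (fun ω b i r => U b i r ω) P

/-- The statistical error level `δ_{n,t} = N L √(log n / n) + √(t / n)`. -/
def statError (N L n : ℕ) (t : ℝ) : ℝ :=
  (N : ℝ) * L * √(Real.log n / n) + √(t / n)

end

/-!
# An oracle inequality for kernel distributional regression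

After embedding by the feature map `Φ` of the kernel, the problem is least squares regression with
values in a Hilbert space: the kernel objective estimates, up to a term that does not depend on `g`,
the mean of `‖μ_g(X) - Φ(Y)‖²`, whose minimizer over all functions of `X` is `μ⋆`. There are two
sources of randomness, treated separately.

* *Data.* For fixed `g`, the excess loss of `μ_g` over `μ⋆` has mean `‖μ_g - μ⋆‖₂²`
  (`integral_sqLoss_sub_sqLoss`) and a second moment at most `16 κ²` times its mean
  (`integral_excess_sq_le`). A Bernstein inequality under this variance condition
  (`measure_sum_ge_le_of_integral_sq_le`, `measure_sum_le_le_of_integral_sq_le`) shows that the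
  empirical excess risk is within a factor `1/2` or `3/2` of `‖μ_g - μ⋆‖₂²`, up to `κ² s / n` with
  probability `1 - e^{-s}`. This yields the fast rate `κ² δ²`.

* *Simulated noise.* Conditionally on the data, the kernel objective is an average of `m₁ n`
  independent U-statistics of order two in `m₂` variables (`kernelLoss_eq_uStatistic`). Hoeffding's
  decomposition of a U-statistic as an average, over permutations, of means of `m₂ / 2` independent
  terms gives a sub-Gaussian bound with variance proxy of order `κ⁴ / (n m₁ m₂)`
  (`measure_uStatistic_ge_le`). This is the term `κ² δ / √(m₁ m₂)`.

Uniformity over the class comes from a finite net (`exists_finset_stochReLU`). The network has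
`O(N² L)` parameters and depends on them in a Lipschitz way with constant `n ^ O(L)`
(`ReLUParams.abs_eval_sub_le`), so rounding the parameters gives a net of log-cardinality
`O(N² L² log n)`, which is at most a constant times `n δ²`. The net is so fine that replacing a
network by its neighbour changes all risks by `O(κ² / n)`, as the feature map is `1/2`-Hölder. The
theorem follows by comparing the estimator with a nearly optimal fixed network `g₀`: the deviation
bounds are needed for the whole net in one direction and for `g₀` alone in the other
(`exists_event_deviation_le`), four events of probability `e^{-t}` each.
-/

/-! ### Truncation and the hidden layers -/

lemma truncate_eq_max_min {M : ℝ} (hM : 0 < M) (z : ℝ) : truncate M z = max (-M) (min z M) := by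
  unfold truncate
  rcases lt_trichotomy z 0 with h | rfl | h
  · rw [Real.sign_of_neg h, abs_of_neg h]
    rcases le_total (-z) M with h' | h'
    · rw [min_eq_left h', min_eq_left (by linarith), max_eq_right (by linarith)]; ring
    · rw [min_eq_right h', min_eq_left (by linarith), max_eq_left (by linarith)]; ring
  · simp [hM.le]
  · rw [Real.sign_of_pos h, abs_of_pos h, mul_one, max_eq_right]
    exact le_min (by linarith) (by linarith)

lemma truncate_mem_Icc {M : ℝ} (hM : 0 < M) (z : ℝ) : truncate M z ∈ Set.Icc (-M) M := by
  rw [truncate_eq_max_min hM]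
  exact ⟨le_max_left _ _, max_le (by linarith) (min_le_right _ _)⟩

lemma continuous_truncate {M : ℝ} (hM : 0 < M) : Continuous (truncate M) := by
  simp_rw [funext (truncate_eq_max_min hM)]
  fun_prop

lemma abs_truncate_sub_le {M : ℝ} (hM : 0 < M) (z z' : ℝ) :
    |truncate M z - truncate M z'| ≤ |z - z'| := by
  simp_rw [truncate_eq_max_min hM]
  refine (abs_max_sub_max_le_max _ _ _ _).trans (max_le (by simp) ?_)
  exact (abs_min_sub_min_le_max _ _ _ _).trans (max_le le_rfl (by simp))

lemma abs_relu_le {N : ℕ} (z : Fin N → ℝ) (j : Fin N) : |relu z j| ≤ |z j| := by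
  simpa [relu] using abs_max_sub_max_le_max 0 (z j) 0 0

lemma abs_relu_sub_le {N : ℕ} (z z' : Fin N → ℝ) (j : Fin N) :
    |relu z j - relu z' j| ≤ |z j - z' j| := by
  refine (abs_max_sub_max_le_max _ _ _ _).trans (max_le (by simp) le_rfl)

lemma abs_dotProduct_add_le {d : ℕ} {w h : Fin d → ℝ} {b B H : ℝ}
    (hw : ∀ j, |w j| ≤ B) (hb : |b| ≤ B) (hh : ∀ j, |h j| ≤ H) (hB : 0 ≤ B) (hH : 1 ≤ H) :
    |w ⬝ᵥ h + b| ≤ (d + 1) * B * H := by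
  have h1 : |w ⬝ᵥ h| ≤ ∑ _j : Fin d, B * H := by
    refine (Finset.abs_sum_le_sum_abs _ _).trans (Finset.sum_le_sum fun j _ => ?_)
    rw [abs_mul]
    exact mul_le_mul (hw j) (hh j) (abs_nonneg _) hB
  simp only [Finset.sum_const, Finset.card_univ, Fintype.card_fin, nsmul_eq_mul] at h1
  have h2 := abs_add_le (w ⬝ᵥ h) b
  nlinarith [mul_nonneg hB (sub_nonneg.2 hH)]

lemma abs_dotProduct_add_sub_le {d : ℕ} {w w' h h' : Fin d → ℝ} {b b' B H η Δ : ℝ}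
    (hw' : ∀ j, |w' j| ≤ B) (hww : ∀ j, |w j - w' j| ≤ η) (hbb : |b - b'| ≤ η)
    (hh : ∀ j, |h j| ≤ H) (hhh : ∀ j, |h j - h' j| ≤ Δ) (hB : 1 ≤ B) (hH : 1 ≤ H) (hη : 0 ≤ η)
    (hΔ : 0 ≤ Δ) :
    |(w ⬝ᵥ h + b) - (w' ⬝ᵥ h' + b')| ≤ (d + 1) * B * (Δ + H * η) := by
  have h1 : |w ⬝ᵥ h - w' ⬝ᵥ h'| ≤ ∑ _j : Fin d, B * (Δ + H * η) := by
    simp only [dotProduct, ← Finset.sum_sub_distrib]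
    refine (Finset.abs_sum_le_sum_abs _ _).trans (Finset.sum_le_sum fun j _ => ?_)
    have e : w j * h j - w' j * h' j = (w j - w' j) * h j + w' j * (h j - h' j) := by ring
    rw [e]
    refine (abs_add_le _ _).trans ?_
    rw [abs_mul, abs_mul]
    have a1 := mul_le_mul (hww j) (hh j) (abs_nonneg _) hη
    have a2 := mul_le_mul (hw' j) (hhh j) (abs_nonneg _) (by linarith)
    have a3 : 0 ≤ (B - 1) * (H * η) := mul_nonneg (by linarith) (by positivity)
    linarith
  simp only [Finset.sum_const, Finset.card_univ, Fintype.card_fin, nsmul_eq_mul] at h1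
  have h2 := abs_add_le (w ⬝ᵥ h - w' ⬝ᵥ h') (b - b')
  have h3 : w ⬝ᵥ h + b - (w' ⬝ᵥ h' + b') = w ⬝ᵥ h - w' ⬝ᵥ h' + (b - b') := by ring
  rw [h3]
  have a3 : 0 ≤ (B - 1) * (H * η) := mul_nonneg (by linarith) (by positivity)
  have a4 : 0 ≤ (H - 1) * η := mul_nonneg (by linarith) hη
  have a5 : 0 ≤ B * Δ := by positivity
  linarith

/-- Propagation of the size of a signal, and of the effect of a perturbation by `η` of all weights
and biases, through `k` hidden layers: each layer multiplies the size by at most `K`, and adds one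
more unit of relative perturbation. -/
lemma foldl_relu_le_and_sub_le {N : ℕ} {B K η : ℝ} (hB : 1 ≤ B) (hK : K = (N + 1) * B)
    (hη : 0 ≤ η) (k : ℕ) (W W' : Fin k → Matrix (Fin N) (Fin N) ℝ) (b b' : Fin k → Fin N → ℝ)
    (hW : ∀ l i j, |W l i j| ≤ B) (hb : ∀ l i, |b l i| ≤ B)
    (hW' : ∀ l i j, |W' l i j| ≤ B)
    (hWW : ∀ l i j, |W l i j - W' l i j| ≤ η) (hbb : ∀ l i, |b l i - b' l i| ≤ η)
    (h h' : Fin N → ℝ) {H a : ℝ} (hH : 1 ≤ H) (ha : 0 ≤ a) (hh : ∀ j, |h j| ≤ H)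
    (hhh : ∀ j, |h j - h' j| ≤ a * H * η) :
    (∀ j, |Fin.foldl k (fun h l => relu (W l *ᵥ h + b l)) h j| ≤ K ^ k * H) ∧
    ∀ j, |Fin.foldl k (fun h l => relu (W l *ᵥ h + b l)) h j
        - Fin.foldl k (fun h l => relu (W' l *ᵥ h + b' l)) h' j| ≤ (a + k) * (K ^ k * H) * η := by
  have hK1 : 1 ≤ K := by rw [hK]; nlinarith [(Nat.cast_nonneg N : (0 : ℝ) ≤ N)]
  induction k with
  | zero => simpa using ⟨hh, hhh⟩
  | succ k ih =>
    obtain ⟨i1, i2⟩ := ih (fun l => W l.castSucc) (fun l => W' l.castSucc)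
      (fun l => b l.castSucc) (fun l => b' l.castSucc) (fun _ => hW _) (fun _ => hb _)
      (fun _ => hW' _) (fun _ => hWW _) (fun _ => hbb _)
    have hKH : 1 ≤ K ^ k * H := one_le_mul_of_one_le_of_one_le (one_le_pow₀ hK1) hH
    simp only [Fin.foldl_succ_last]
    refine ⟨fun j => ?_, fun j => ?_⟩
    · refine (abs_relu_le _ _).trans ((abs_dotProduct_add_le (hW (Fin.last k) j)
        (hb (Fin.last k) j) i1 (by linarith) hKH).trans (le_of_eq ?_))
      rw [← hK]; ring
    · refine (abs_relu_sub_le _ _ _).trans ((abs_dotProduct_add_sub_le (hW' (Fin.last k) j)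
        (hWW (Fin.last k) j) (hbb (Fin.last k) j) i1 i2 hB hKH hη (by positivity)).trans
        (le_of_eq ?_))
      rw [← hK]; push_cast; ring

namespace ReLUParams

variable {d L N : ℕ}

/-- All weights and biases of two networks differ by at most `η`. -/
def Near (θ θ' : ReLUParams d L N) (η : ℝ) : Prop :=
  (∀ i j, |θ.Win i j - θ'.Win i j| ≤ η) ∧ (∀ i, |θ.bin i - θ'.bin i| ≤ η) ∧
  (∀ l i j, |θ.W l i j - θ'.W l i j| ≤ η) ∧ (∀ l i, |θ.b l i - θ'.b l i| ≤ η) ∧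
  (∀ j, |θ.Wout j - θ'.Wout j| ≤ η) ∧ |θ.bout - θ'.bout| ≤ η

/-- On bounded inputs the realized function is Lipschitz in the parameters. -/
lemma abs_eval_sub_le {θ θ' : ReLUParams d L N} {B K c η : ℝ} (hL : 1 ≤ L) (hd : d ≤ N)
    (hθ : θ.BoundedBy B) (hθ' : θ'.BoundedBy B) (hB : 1 ≤ B) (hK : K = (N + 1) * B) (hc : 1 ≤ c)
    (hη : 0 ≤ η) (h : θ.Near θ' η) {z : Fin d → ℝ} (hz : ∀ j, |z j| ≤ c) :
    |θ.eval z - θ'.eval z| ≤ (L + 1) * c * K ^ (L + 1) * η := by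
  obtain ⟨n1, n2, n3, n4, n5, n6⟩ := h
  obtain ⟨p1, p2, p3, p4, p5, p6⟩ := hθ
  obtain ⟨q1, q2, q3, q4, q5, q6⟩ := hθ'
  have hK1 : 1 ≤ K := by rw [hK]; nlinarith [(Nat.cast_nonneg N : (0 : ℝ) ≤ N)]
  have hdK : (d + 1) * B ≤ K := by
    rw [hK]; have : (d : ℝ) ≤ N := by exact_mod_cast hd
    nlinarith
  have f1 : ∀ j, |relu (θ.Win *ᵥ z + θ.bin) j| ≤ K * c := fun j =>
    (abs_relu_le _ _).trans ((abs_dotProduct_add_le (p1 j) (p2 j) hz (by linarith) hc).trans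
      (by nlinarith))
  have f2 : ∀ j, |relu (θ.Win *ᵥ z + θ.bin) j - relu (θ'.Win *ᵥ z + θ'.bin) j|
      ≤ 1 * (K * c) * η := fun j => by
    refine (abs_relu_sub_le _ _ _).trans ((abs_dotProduct_add_sub_le (q1 j) (n1 j) (n2 j) hz
      (Δ := 0) (by simp) hB hc hη le_rfl).trans ?_)
    have := mul_le_mul_of_nonneg_right hdK (by positivity : 0 ≤ c * η)
    linarith
  have hKc : 1 ≤ K * c := one_le_mul_of_one_le_of_one_le hK1 hc
  obtain ⟨g1, g2⟩ := foldl_relu_le_and_sub_le hB hK hη (L - 1) θ.W θ'.W θ.b θ'.b p3 p4 q3 n3 n4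
    _ _ hKc zero_le_one f1 f2
  have hKc' : 1 ≤ K ^ (L - 1) * (K * c) :=
    one_le_mul_of_one_le_of_one_le (one_le_pow₀ hK1) hKc
  refine (abs_dotProduct_add_sub_le q5 n5 n6 g1 g2 hB hKc' hη (by positivity)).trans
    (le_of_eq ?_)
  obtain ⟨m, rfl⟩ : ∃ m, L = m + 1 := ⟨L - 1, by omega⟩
  rw [← hK, Nat.add_sub_cancel]; push_cast; ring

lemma continuous_eval (θ : ReLUParams d L N) : Continuous θ.eval := by
  have key : ∀ (k : ℕ) (W : Fin k → Matrix (Fin N) (Fin N) ℝ) (b : Fin k → Fin N → ℝ)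
      (f : (Fin d → ℝ) → Fin N → ℝ), Continuous f →
      Continuous fun z => Fin.foldl k (fun h l => relu (W l *ᵥ h + b l)) (f z) := by
    intro k
    induction k with
    | zero => intro W b f hf; simpa using hf
    | succ k ih =>
      intro W b f hf
      simp only [Fin.foldl_succ_last]
      have := ih (fun l => W l.castSucc) (fun l => b l.castSucc) f hf
      refine continuous_pi fun j => ?_
      simp only [relu, Pi.add_apply, Matrix.mulVec, dotProduct]
      refine continuous_const.max ((continuous_finsetSum _ fun i _ => ?_).add continuous_const)
      exact continuous_const.mul ((continuous_apply i).comp this)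
  have h1 : Continuous fun z : Fin d → ℝ => relu (θ.Win *ᵥ z + θ.bin) := by
    refine continuous_pi fun j => ?_
    simp only [relu, Pi.add_apply, Matrix.mulVec, dotProduct]
    fun_prop
  have h2 := key (L - 1) θ.W θ.b _ h1
  unfold eval
  refine Continuous.add ?_ continuous_const
  simp only [dotProduct]
  exact continuous_finsetSum _ fun i _ => continuous_const.mul ((continuous_apply i).comp h2)

end ReLUParams

/-! ### A finite net of networks -/

/-- A set on which a finite code is defined contains, for every code that occurs, a representative:
these representatives form a finite subset of at most as many elements as there are codes. -/
lemma exists_finset_representatives {α ι : Type*} [Fintype ι] (S : Set α) (code : α → ι) :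
    ∃ T : Finset α, ↑T ⊆ S ∧ T.card ≤ Fintype.card ι ∧ ∀ x ∈ S, ∃ y ∈ T, code x = code y := by
  classical
  choose r hr using fun c : code '' S => c.2
  refine ⟨Finset.univ.image r, ?_, ?_, ?_⟩
  · intro x hx
    simp only [Finset.coe_image, Finset.coe_univ, Set.image_univ, Set.mem_range] at hx
    obtain ⟨c, rfl⟩ := hx
    exact (hr c).1
  · exact Finset.card_image_le.trans (Fintype.card_subtype_le _)
  · intro x hx
    exact ⟨r ⟨code x, x, hx, rfl⟩, Finset.mem_image_of_mem _ (Finset.mem_univ _),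
      (hr ⟨code x, x, hx, rfl⟩).2.symm⟩

/-- Index of the cell of length `η` of `[-B, B]` that contains `x`, counted from `-B` and capped at `m`
so as to lie in `Fin (m + 1)`; the cap is inactive for `|x| ≤ B` when `m ≥ 2 B / η` up to rounding. -/
noncomputable def cellIndex (B η : ℝ) (m : ℕ) (x : ℝ) : Fin (m + 1) :=
  ⟨min ⌊(x + B) / η⌋₊ m, Nat.lt_succ_of_le (min_le_right _ _)⟩

lemma abs_sub_le_of_cellIndex_eq {B η x y : ℝ} {m : ℕ} (hη : 0 < η) (hm : m = ⌊2 * B / η⌋₊)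
    (hx : |x| ≤ B) (hy : |y| ≤ B) (h : cellIndex B η m x = cellIndex B η m y) :
    |x - y| ≤ η := by
  rw [abs_le] at hx hy
  have bd : ∀ {w : ℝ}, -B ≤ w → w ≤ B → ⌊(w + B) / η⌋₊ ≤ m := fun {w} h1 h2 => by
    rw [hm]; exact Nat.floor_le_floor (by gcongr; linarith)
  have h' : ⌊(x + B) / η⌋₊ = ⌊(y + B) / η⌋₊ := by
    have := congrArg Fin.val h
    simpa [cellIndex, min_eq_left (bd hx.1 hx.2), min_eq_left (bd hy.1 hy.2)] using this
  have x1 := Nat.floor_le (div_nonneg (by linarith : 0 ≤ x + B) hη.le)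
  have x2 := Nat.lt_floor_add_one ((x + B) / η)
  have y1 := Nat.floor_le (div_nonneg (by linarith : 0 ≤ y + B) hη.le)
  have y2 := Nat.lt_floor_add_one ((y + B) / η)
  rw [h'] at x1 x2
  rw [le_div_iff₀ hη] at x1 y1
  rw [div_lt_iff₀ hη] at x2 y2
  rw [abs_le]; constructor <;> nlinarith

namespace ReLUParams

variable {d L N : ℕ}

/-- The number of weights and biases of a network. -/
def numParams (d L N : ℕ) : ℕ := N * d + N + (L - 1) * N * N + (L - 1) * N + N + 1

lemma exists_finset_near (d L N : ℕ) {B η : ℝ} (hη : 0 < η) :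
    ∃ T : Finset (ReLUParams d L N), (∀ θ ∈ T, θ.BoundedBy B) ∧
      T.card ≤ (⌊2 * B / η⌋₊ + 1) ^ numParams d L N ∧
      ∀ θ : ReLUParams d L N, θ.BoundedBy B → ∃ θ' ∈ T, θ.Near θ' η := by
  set m := ⌊2 * B / η⌋₊ with hm
  let q := cellIndex B η m
  let code : ReLUParams d L N → (Fin N → Fin d → Fin (m + 1)) × (Fin N → Fin (m + 1)) ×
      (Fin (L - 1) → Fin N → Fin N → Fin (m + 1)) × (Fin (L - 1) → Fin N → Fin (m + 1)) ×
      (Fin N → Fin (m + 1)) × Fin (m + 1) := fun θ =>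
    (fun i j => q (θ.Win i j), fun i => q (θ.bin i), fun l i j => q (θ.W l i j),
      fun l i => q (θ.b l i), fun j => q (θ.Wout j), q θ.bout)
  obtain ⟨T, hT, hcard, hrep⟩ := exists_finset_representatives {θ | θ.BoundedBy B} code
  refine ⟨T, fun θ h => hT h, hcard.trans (le_of_eq ?_), fun θ hθ => ?_⟩
  · simp only [Fintype.card_prod, Fintype.card_pi, Fintype.card_fin, Finset.prod_const,
      Finset.card_univ, numParams]
    ring
  · obtain ⟨θ', h', e⟩ := hrep θ hθ
    refine ⟨θ', h', ?_⟩
    obtain ⟨p1, p2, p3, p4, p5, p6⟩ := hθ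
    obtain ⟨q1, q2, q3, q4, q5, q6⟩ := hT h'
    simp only [code, Prod.mk.injEq, funext_iff] at e
    obtain ⟨e1, e2, e3, e4, e5, e6⟩ := e
    exact ⟨fun i j => abs_sub_le_of_cellIndex_eq hη hm (p1 i j) (q1 i j) (e1 i j),
      fun i => abs_sub_le_of_cellIndex_eq hη hm (p2 i) (q2 i) (e2 i),
      fun l i j => abs_sub_le_of_cellIndex_eq hη hm (p3 l i j) (q3 l i j) (e3 l i j),
      fun l i => abs_sub_le_of_cellIndex_eq hη hm (p4 l i) (q4 l i) (e4 l i),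
      fun j => abs_sub_le_of_cellIndex_eq hη hm (p5 j) (q5 j) (e5 j),
      abs_sub_le_of_cellIndex_eq hη hm p6 q6 e6⟩

lemma numParams_le (hL : 1 ≤ L) (hN : 1 ≤ N) (hd : d ≤ N) :
    numParams d L N ≤ 4 * (N ^ 2 * L) := by
  obtain ⟨k, rfl⟩ : ∃ k, L = k + 1 := ⟨L - 1, by omega⟩
  simp only [numParams, Nat.add_sub_cancel]
  have h1 : N * d ≤ N * N := Nat.mul_le_mul_left _ hd
  have h2 : N ≤ N * N := Nat.le_mul_of_pos_left _ hN
  have h3 : k * N ≤ k * (N * N) := Nat.mul_le_mul_left _ h2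
  nlinarith

end ReLUParams

lemma stochReLU_mem_Icc {p q L N : ℕ} {M B : ℝ} (hM : 0 < M)
    {g : (Fin p → ℝ) → (Fin q → ℝ) → ℝ} (hg : g ∈ stochReLU p q L N M B) (x : Fin p → ℝ)
    (u : Fin q → ℝ) : g x u ∈ Set.Icc (-M) M := by
  obtain ⟨θ, -, rfl⟩ := hg
  exact truncate_mem_Icc hM _

lemma continuous_uncurry_of_mem_stochReLU {p q L N : ℕ} {M B : ℝ} (hM : 0 < M)
    {g : (Fin p → ℝ) → (Fin q → ℝ) → ℝ} (hg : g ∈ stochReLU p q L N M B) :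
    Continuous fun z : (Fin p → ℝ) × (Fin q → ℝ) => g z.1 z.2 := by
  obtain ⟨θ, -, rfl⟩ := hg
  refine (continuous_truncate hM).comp (θ.continuous_eval.comp (continuous_pi fun j => ?_))
  refine Fin.addCases (fun i => ?_) (fun i => ?_) j
  · simp only [Fin.append_left]; fun_prop
  · simp only [Fin.append_right]; fun_prop

lemma stochReLU_nonempty (p q L N : ℕ) (M : ℝ) {B : ℝ} (hB : 0 < B) :
    (stochReLU p q L N M B).Nonempty :=
  ⟨_, ⟨fun _ _ => 0, fun _ => 0, fun _ _ _ => 0, fun _ _ => 0, fun _ => 0, 0⟩,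
    by simp [ReLUParams.BoundedBy, hB.le], rfl⟩

set_option maxHeartbeats 800000 in
/-- A finite family of networks that is `1 / (r n²)`-dense in the class, uniformly on the supports
of the covariates and of the noise, and whose log-cardinality is of order `N² L² log n`: there
are `O(N² L)` parameters, and each is discretized to a precision of `n ^ {-O(L)}`. -/
lemma exists_finset_stochReLU (c₀ c₁ r : ℝ) (hr : 1 ≤ r) :
    ∃ A : ℝ, 1 ≤ A ∧ ∀ (p q n L N : ℕ) (M B : ℝ), 3 ≤ n → 3 ≤ L → p + q + 2 ≤ N → 0 < M → 0 < B →
      Real.log B ≤ c₁ * Real.log n → Real.log ((N : ℝ) * L) ≤ c₁ * Real.log n →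
      ∃ T : Finset ((Fin p → ℝ) → (Fin q → ℝ) → ℝ), ↑T ⊆ stochReLU p q L N M B ∧
        Real.log T.card ≤ A * ((N : ℝ) ^ 2 * L ^ 2 * Real.log n) ∧
        ∀ g ∈ stochReLU p q L N M B, ∃ g' ∈ T, ∀ x u, (∀ j, x j ∈ Set.Icc (-c₀) c₀) →
          (∀ j, u j ∈ Set.Icc (0 : ℝ) 1) → |g x u - g' x u| ≤ 1 / (r * n ^ 2) := by
  classical
  set c := max c₀ 1 with hc
  set C1 := max c₁ 0 with hC1
  have hc1 : 1 ≤ c := le_max_right _ _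
  have hlc : 0 ≤ Real.log c := Real.log_nonneg hc1
  have hlr : 0 ≤ Real.log r := Real.log_nonneg hr
  have hC0 : 0 ≤ C1 := le_max_right _ _
  refine ⟨4 * (7 + 6 * C1 + Real.log c + Real.log r), by nlinarith, ?_⟩
  intro p q n L N M B hn hL hN hM hB hlB hlNL
  have hn' : (3 : ℝ) ≤ n := by exact_mod_cast hn
  have hL' : (3 : ℝ) ≤ L := by exact_mod_cast hL
  have hN2 : 2 ≤ N := by omega
  have hN' : (2 : ℝ) ≤ N := by exact_mod_cast hN2
  have hl1 : 1 ≤ Real.log n := by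
    rw [Real.le_log_iff_exp_le (by linarith)]
    exact (Real.exp_one_lt_d9.le.trans (by norm_num)).trans hn'
  set l := Real.log n with hl
  have hCl : c₁ * l ≤ C1 * l := mul_le_mul_of_nonneg_right (le_max_left _ _) (by linarith)
  have hCl0 : 0 ≤ C1 * l := mul_nonneg hC0 (by linarith)
  set B' := max B 1 with hB'
  have hB1 : 1 ≤ B' := le_max_right _ _
  have hlB' : Real.log B' ≤ C1 * l := by
    rcases le_total B 1 with h | h
    · rw [hB', max_eq_right h, Real.log_one]; exact hCl0
    · rw [hB', max_eq_left h]; linarith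
  set K : ℝ := (N + 1) * B' with hK
  have hK1 : 1 ≤ K := by rw [hK]; nlinarith
  have hl2 : Real.log 2 ≤ 1 := by linarith [Real.log_two_lt_d9]
  have hlNl : Real.log N + Real.log L ≤ C1 * l := by
    rw [← Real.log_mul (by positivity) (by positivity)]; linarith
  have hlN0 : 0 ≤ Real.log N := Real.log_nonneg (by linarith)
  have hlL0 : 0 ≤ Real.log L := Real.log_nonneg (by linarith)
  have hlN1 : Real.log (N + 1) ≤ 1 + Real.log N := by
    calc Real.log (N + 1) ≤ Real.log (2 * N) := Real.log_le_log (by positivity) (by linarith)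
      _ = Real.log 2 + Real.log N := Real.log_mul (by positivity) (by positivity)
      _ ≤ _ := by linarith
  have hlL1 : Real.log (L + 1) ≤ 1 + Real.log L := by
    calc Real.log (L + 1) ≤ Real.log (2 * L) := Real.log_le_log (by positivity) (by linarith)
      _ = Real.log 2 + Real.log L := Real.log_mul (by positivity) (by positivity)
      _ ≤ _ := by linarith
  have hlK : Real.log K ≤ 1 + 2 * (C1 * l) := by
    rw [hK, Real.log_mul (by positivity) (by positivity)]; linarith
  set ε : ℝ := 1 / (r * n ^ 2) with hε
  have hε0 : 0 < ε := by positivity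
  -- the parameter precision that the Lipschitz bound turns into the precision `ε` of the outputs
  set η : ℝ := ε / ((L + 1) * c * K ^ (L + 1)) with hη
  have hD : 0 < (L + 1) * c * K ^ (L + 1) := by positivity
  have hη0 : 0 < η := by positivity
  obtain ⟨T, hT, hcard, hnear⟩ := ReLUParams.exists_finset_near (p + q) L N (B := B) hη0
  refine ⟨T.image fun θ x u => truncate M (θ.eval (Fin.append x u)), ?_, ?_, ?_⟩
  · intro g hg
    simp only [Finset.coe_image, Set.mem_image] at hg
    obtain ⟨θ, hθ, rfl⟩ := hg
    exact ⟨θ, hT θ hθ, rfl⟩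
  · -- the number of cells per parameter is at most `3 B' / η`
    set G : ℝ := 3 * B' * ((L + 1) * c * K ^ (L + 1)) * (r * n ^ 2) with hG
    have hG1 : 1 ≤ B' * ((L + 1) * c * K ^ (L + 1)) * (r * n ^ 2) := by
      have := one_le_pow₀ hK1 (n := L + 1)
      have a1 : 1 ≤ ((L : ℝ) + 1) * c := one_le_mul_of_one_le_of_one_le (by linarith) hc1
      have a2 : 1 ≤ ((L : ℝ) + 1) * c * K ^ (L + 1) := one_le_mul_of_one_le_of_one_le a1 this
      have a3 : 1 ≤ r * (n : ℝ) ^ 2 :=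
        one_le_mul_of_one_le_of_one_le hr (one_le_pow₀ (by linarith))
      exact one_le_mul_of_one_le_of_one_le (one_le_mul_of_one_le_of_one_le hB1 a2) a3
    have hGm : ((⌊2 * B / η⌋₊ + 1 : ℕ) : ℝ) ≤ G := by
      push_cast
      have h1 : (⌊2 * B / η⌋₊ : ℝ) ≤ 2 * B / η := Nat.floor_le (by positivity)
      have h2 : 2 * B / η ≤ 2 * B' / η := by
        gcongr; exact le_max_left _ _
      have h3 : 2 * B' / η = 2 * (B' * ((L + 1) * c * K ^ (L + 1)) * (r * n ^ 2)) := by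
        rw [hη, hε]; field_simp
      rw [hG]; nlinarith
    have hlG : Real.log G ≤ (7 + 6 * C1 + Real.log c + Real.log r) * L * l := by
      have e : Real.log G = Real.log 3 + Real.log B' + (Real.log (L + 1) + Real.log c +
          (L + 1 : ℕ) * Real.log K) + (Real.log r + 2 * l) := by
        rw [hG, Real.log_mul (by positivity) (by positivity), Real.log_mul (by positivity)
          (by positivity), Real.log_mul (by positivity) (by positivity), Real.log_mul
          (by positivity) (by positivity), Real.log_mul (by positivity) (by positivity),
          Real.log_mul (by positivity) (by positivity), Real.log_pow, Real.log_pow]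
        push_cast; ring
      have h3 : Real.log 3 ≤ l := Real.log_le_log (by norm_num) hn'
      rw [e]; push_cast
      have a1 : ((L : ℝ) + 1) * Real.log K ≤ (L + 1) * (1 + 2 * (C1 * l)) := by gcongr
      have a2 : 3 * l ≤ L * l := by gcongr
      have a3 : 3 * (C1 * l) ≤ L * (C1 * l) := by gcongr
      have a4 : (L : ℝ) * 1 ≤ L * l := by gcongr
      have a5 : Real.log c * 1 ≤ Real.log c * (L * l) := by
        gcongr; nlinarith
      have a6 : Real.log r * 1 ≤ Real.log r * (L * l) := by
        gcongr; nlinarith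
      have a7 : 0 ≤ L * (C1 * l) := by positivity
      have a8 : 0 ≤ (L : ℝ) * l := by positivity
      linarith
    have hcard' : ((T.image fun (θ : ReLUParams (p + q) L N) (x : Fin p → ℝ) (u : Fin q → ℝ) =>
        truncate M (θ.eval (Fin.append x u))).card : ℝ)
        ≤ G ^ ReLUParams.numParams (p + q) L N := by
      calc _ ≤ ((⌊2 * B / η⌋₊ + 1 : ℕ) : ℝ) ^ ReLUParams.numParams (p + q) L N := by
            exact_mod_cast Finset.card_image_le.trans hcard
        _ ≤ _ := by gcongr
    have hnp : (ReLUParams.numParams (p + q) L N : ℝ) ≤ 4 * (N ^ 2 * L) := by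
      exact_mod_cast ReLUParams.numParams_le (by omega) (by omega) (by omega)
    have hlG0 : 0 ≤ Real.log G := Real.log_nonneg (by rw [hG]; linarith)
    rcases Nat.eq_zero_or_pos (T.image fun (θ : ReLUParams (p + q) L N) (x : Fin p → ℝ)
      (u : Fin q → ℝ) => truncate M (θ.eval (Fin.append x u))).card with h0 | h0
    · rw [h0]; simp only [Nat.cast_zero, Real.log_zero]; positivity
    · calc _ ≤ Real.log (G ^ ReLUParams.numParams (p + q) L N) :=
            Real.log_le_log (by exact_mod_cast h0) hcard'
        _ = ReLUParams.numParams (p + q) L N * Real.log G := Real.log_pow _ _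
        _ ≤ 4 * (N ^ 2 * L) * ((7 + 6 * C1 + Real.log c + Real.log r) * L * l) := by gcongr
        _ = _ := by ring
  · rintro g ⟨θ, hθ, rfl⟩
    obtain ⟨θ', hθ', hnr⟩ := hnear θ hθ
    refine ⟨_, Finset.mem_image_of_mem _ hθ', fun x u hx hu => ?_⟩
    refine (abs_truncate_sub_le hM _ _).trans ?_
    have mono : ∀ {ϑ : ReLUParams (p + q) L N}, ϑ.BoundedBy B → ϑ.BoundedBy B' := by
      rintro ϑ ⟨p1, p2, p3, p4, p5, p6⟩
      have hBB : B ≤ B' := le_max_left _ _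
      exact ⟨fun i j => (p1 i j).trans hBB, fun i => (p2 i).trans hBB,
        fun l i j => (p3 l i j).trans hBB, fun l i => (p4 l i).trans hBB,
        fun j => (p5 j).trans hBB, p6.trans hBB⟩
    refine (ReLUParams.abs_eval_sub_le (c := c) (by omega) (by omega) (mono hθ)
      (mono (hT θ' hθ')) hB1 hK hc1 hη0.le hnr (fun j => ?_)).trans (le_of_eq ?_)
    · refine Fin.addCases (fun i => ?_) (fun i => ?_) j
      · rw [Fin.append_left]
        exact (abs_le.2 (hx i)).trans (le_max_left _ _)
      · rw [Fin.append_right, abs_of_nonneg (hu i).1]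
        exact (hu i).2.trans (le_max_right _ _)
    · rw [hη]; field_simp

/-! ### Concentration of U-statistics -/

/-- An average of sub-Gaussian variables with a common parameter is sub-Gaussian with the same
parameter, without any independence, by convexity of the exponential. -/
lemma hasSubgaussianMGF_average {ι Ω : Type*} [Fintype ι] [Nonempty ι] [MeasurableSpace Ω]
    {P : Measure Ω} {X : ι → Ω → ℝ} {c : NNReal} (h : ∀ i, HasSubgaussianMGF (X i) c P) :
    HasSubgaussianMGF (fun ω => (Fintype.card ι : ℝ)⁻¹ * ∑ i, X i ω) c P := by
  have hcard : (0 : ℝ) < Fintype.card ι := by exact_mod_cast Fintype.card_pos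
  have key : ∀ t ω, Real.exp (t * ((Fintype.card ι : ℝ)⁻¹ * ∑ i, X i ω))
      ≤ (Fintype.card ι : ℝ)⁻¹ * ∑ i, Real.exp (t * X i ω) := by
    intro t ω
    have := convexOn_exp.map_sum_le (t := Finset.univ)
      (w := fun _ : ι => (Fintype.card ι : ℝ)⁻¹) (p := fun i => t * X i ω)
      (fun _ _ => by positivity) (by simp) (fun _ _ => Set.mem_univ _)
    simp only [smul_eq_mul, ← Finset.mul_sum] at this
    rwa [mul_left_comm]
  have hint : ∀ t, Integrable (fun ω => (Fintype.card ι : ℝ)⁻¹ * ∑ i, Real.exp (t * X i ω)) P :=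
    fun t => (integrable_finsetSum _ fun i _ => (h i).integrable_exp_mul t).const_mul _
  have hm : AEMeasurable (fun ω => (Fintype.card ι : ℝ)⁻¹ * ∑ i, X i ω) P :=
    (Finset.aemeasurable_fun_sum _ fun i _ => (h i).aemeasurable).const_mul _
  have hint' : ∀ t, Integrable
      (fun ω => Real.exp (t * ((Fintype.card ι : ℝ)⁻¹ * ∑ i, X i ω))) P := fun t =>
    (hint t).mono' (Real.measurable_exp.comp_aemeasurable (hm.const_mul t)).aestronglyMeasurable
      (ae_of_all _ fun ω => by rw [Real.norm_of_nonneg (Real.exp_pos _).le]; exact key t ω)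
  refine ⟨hint', fun t => ?_⟩
  calc mgf (fun ω => (Fintype.card ι : ℝ)⁻¹ * ∑ i, X i ω) P t
      ≤ ∫ ω, (Fintype.card ι : ℝ)⁻¹ * ∑ i, Real.exp (t * X i ω) ∂P :=
        integral_mono (hint' t) (hint t) (key t)
    _ = (Fintype.card ι : ℝ)⁻¹ * ∑ i, mgf (X i) P t := by
        rw [integral_const_mul, integral_finsetSum _ fun i _ => (h i).integrable_exp_mul t]; rfl
    _ ≤ (Fintype.card ι : ℝ)⁻¹ * ∑ _i : ι, Real.exp (c * t ^ 2 / 2) := by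
        gcongr with i; exact (h i).mgf_le t
    _ = Real.exp (c * t ^ 2 / 2) := by
        rw [Finset.sum_const, Finset.card_univ, nsmul_eq_mul]; field_simp

/-- Averaging over ordered pairs of distinct points is the same as evaluating at the images of one
fixed pair and averaging over all permutations. -/
lemma sum_erase_eq_sum_perm {m : ℕ} (f : Fin m → Fin m → ℝ) {a b : Fin m} (hab : a ≠ b) :
    1 / ((m : ℝ) * (m - 1)) * ∑ r, ∑ s ∈ Finset.univ.erase r, f r s
      = (Fintype.card (Equiv.Perm (Fin m)) : ℝ)⁻¹ * ∑ σ : Equiv.Perm (Fin m), f (σ a) (σ b) := by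
  have hm : 2 ≤ m := by
    have := a.isLt; have := b.isLt
    by_contra h
    exact hab (Fin.ext (by omega))
  have inv : ∀ r s : Fin m, r ≠ s →
      ∑ σ : Equiv.Perm (Fin m), f (σ r) (σ s) = ∑ σ : Equiv.Perm (Fin m), f (σ a) (σ b) := by
    intro r s hrs
    obtain ⟨τ, h1, h2⟩ := MulAction.is_two_pretransitive_iff.1
      (Equiv.Perm.isMultiplyPretransitive (Fin m) 2) hab hrs
    rw [← h1, ← h2]
    exact Equiv.sum_comp (Equiv.mulRight τ) fun σ : Equiv.Perm (Fin m) => f (σ a) (σ b)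
  have e1 : ∑ σ : Equiv.Perm (Fin m), ∑ r, ∑ s ∈ Finset.univ.erase r, f (σ r) (σ s)
      = Fintype.card (Equiv.Perm (Fin m)) * ∑ r, ∑ s ∈ Finset.univ.erase r, f r s := by
    have : ∀ σ : Equiv.Perm (Fin m), ∑ r, ∑ s ∈ Finset.univ.erase r, f (σ r) (σ s)
        = ∑ r, ∑ s ∈ Finset.univ.erase r, f r s := by
      intro σ
      rw [← Equiv.sum_comp σ (fun r => ∑ s ∈ Finset.univ.erase r, f r s)]
      refine Finset.sum_congr rfl fun r _ => ?_
      refine Finset.sum_bij (fun s _ => σ s) (by simp) (by simp) (fun s hs => ?_) (by simp)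
      refine ⟨σ.symm s, ?_, by simp⟩
      simp only [Finset.mem_erase, Finset.mem_univ, and_true] at hs ⊢
      intro h; apply hs; rw [← h]; simp
    simp only [this, Finset.sum_const, Finset.card_univ, nsmul_eq_mul]
  have e2 : ∑ σ : Equiv.Perm (Fin m), ∑ r, ∑ s ∈ Finset.univ.erase r, f (σ r) (σ s)
      = (m * (m - 1)) * ∑ σ : Equiv.Perm (Fin m), f (σ a) (σ b) := by
    rw [Finset.sum_comm]
    have : ∀ r : Fin m, ∑ σ : Equiv.Perm (Fin m), ∑ s ∈ Finset.univ.erase r, f (σ r) (σ s)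
        = (m - 1) * ∑ σ : Equiv.Perm (Fin m), f (σ a) (σ b) := by
      intro r
      rw [Finset.sum_comm, Finset.sum_congr rfl fun s hs => inv r s (Finset.ne_of_mem_erase hs).symm]
      rw [Finset.sum_const, Finset.card_erase_of_mem (Finset.mem_univ _), Finset.card_univ,
        Fintype.card_fin, nsmul_eq_mul, Nat.cast_sub (by omega), Nat.cast_one]
    simp only [this, Finset.sum_const, Finset.card_univ, Fintype.card_fin, nsmul_eq_mul, mul_assoc]
  have hm' : (2 : ℝ) ≤ m := by exact_mod_cast hm
  have hc : (Fintype.card (Equiv.Perm (Fin m)) : ℝ) ≠ 0 := by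
    exact_mod_cast Fintype.card_ne_zero
  have hm1 : (m : ℝ) - 1 ≠ 0 := by linarith
  have hm0 : (m : ℝ) ≠ 0 := by linarith
  rw [e1] at e2
  field_simp
  linarith

/-- Pairing off an i.i.d. family yields an i.i.d. family of pairs. -/
lemma map_pair_eq_pi {κ S Ω : Type*} [Fintype κ] [MeasurableSpace S] [MeasurableSpace Ω]
    {P : Measure Ω} {μ : Measure S} [IsProbabilityMeasure μ] {Z : κ ⊕ κ → Ω → S}
    (hZ : iIndepFun Z P) (hlaw : ∀ k, HasLaw (Z k) μ P) :
    P.map (fun ω k => (Z (.inl k) ω, Z (.inr k) ω)) = Measure.pi fun _ => μ.prod μ := by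
  have h0 := hZ.map_fun_eq_pi_map fun k => (hlaw k).aemeasurable
  simp_rw [fun k => (hlaw k).map_eq] at h0
  have h1 := (measurePreserving_sumPiEquivProdPi (X := fun _ : κ ⊕ κ => S) (fun _ => μ))
  have h2 := (measurePreserving_arrowProdEquivProdArrow S S κ (fun _ => μ) (fun _ => μ)).symm
  have h3 := h2.comp h1
  rw [← h3.map_eq, ← h0, AEMeasurable.map_map_of_aemeasurable h3.measurable.aemeasurable
    (aemeasurable_pi_lambda _ fun k => (hlaw k).aemeasurable)]
  rfl

lemma iIndepFun_pair {κ S Ω : Type*} [Fintype κ] [MeasurableSpace S] [MeasurableSpace Ω]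
    {P : Measure Ω} {μ : Measure S} [IsProbabilityMeasure μ] {Z : κ ⊕ κ → Ω → S}
    (hZ : iIndepFun Z P) (hlaw : ∀ k, HasLaw (Z k) μ P) :
    iIndepFun (fun k ω => (Z (.inl k) ω, Z (.inr k) ω)) P ∧
      ∀ k, HasLaw (fun ω => (Z (.inl k) ω, Z (.inr k) ω)) (μ.prod μ) P := by
  have := hZ.isProbabilityMeasure
  have hm : ∀ k, AEMeasurable (fun ω => (Z (.inl k) ω, Z (.inr k) ω)) P := fun k =>
    (hlaw _).aemeasurable.prodMk (hlaw _).aemeasurable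
  have h1 : ∀ k, HasLaw (fun ω => (Z (.inl k) ω, Z (.inr k) ω)) (μ.prod μ) P := fun k =>
    ⟨hm k, by
      have h2 : IndepFun (Z (.inl k)) (Z (.inr k)) P := hZ.indepFun (by simp)
      rw [(indepFun_iff_map_prod_eq_prod_map_map (hlaw _).aemeasurable
        (hlaw _).aemeasurable).1 h2, (hlaw _).map_eq, (hlaw _).map_eq]⟩
  refine ⟨?_, h1⟩
  rw [iIndepFun_iff_map_fun_eq_pi_map hm, map_pair_eq_pi hZ hlaw]
  simp_rw [fun k => (h1 k).map_eq]

/-- **Hoeffding's inequality for U-statistics** of order two, averaged over independent blocks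
`j : J` of `m` i.i.d. variables. Writing the U-statistic as an average over permutations of sums over
`m / 2` disjoint, hence independent, pairs gives the sub-Gaussian parameter of `|J| * (m / 2)`
independent terms. -/
lemma measure_uStatistic_ge_le {J S Ω : Type*} [Fintype J] [Nonempty J] [MeasurableSpace S]
    [MeasurableSpace Ω] {P : Measure Ω} {μ : Measure S} [IsProbabilityMeasure μ]
    {m : ℕ} (hm : 2 ≤ m) {U : J × Fin m → Ω → S} (hU : iIndepFun U P)
    (hlaw : ∀ k, HasLaw (U k) μ P) {f : J → S × S → ℝ} (hf : ∀ j, Measurable (f j)) {b : ℝ}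
    (hb : 0 < b) (hfb : ∀ j z, |f j z| ≤ b) {ε : ℝ} (hε : 0 ≤ ε) :
    P.real {ω | ε ≤ (Fintype.card J : ℝ)⁻¹ * ∑ j, (1 / ((m : ℝ) * (m - 1)) *
        ∑ r, ∑ s ∈ Finset.univ.erase r, f j (U (j, r) ω, U (j, s) ω) - ∫ z, f j z ∂(μ.prod μ))}
      ≤ Real.exp (-(ε ^ 2 * Fintype.card J * m) / (6 * b ^ 2)) := by
  classical
  have hP := hU.isProbabilityMeasure
  set h := m / 2 with hh
  have hh1 : 1 ≤ h := by omega
  have hmh : (m : ℝ) ≤ 3 * h := by exact_mod_cast (by omega : m ≤ 3 * h)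
  have hhpos : (0 : ℝ) < h := by exact_mod_cast hh1
  have hJ : (0 : ℝ) < Fintype.card J := by exact_mod_cast Fintype.card_pos
  -- the disjoint pairs `(2 l, 2 l + 1)`, to be permuted by `σ`
  let a : Fin h → Fin m := fun l => ⟨2 * l, by have := l.isLt; omega⟩
  let a' : Fin h → Fin m := fun l => ⟨2 * l + 1, by have := l.isLt; omega⟩
  let θ : J → ℝ := fun j => ∫ z, f j z ∂(μ.prod μ)
  let X : Equiv.Perm (Fin m) → Ω → ℝ := fun σ ω => ((Fintype.card J : ℝ) * h)⁻¹ *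
    ∑ k : J × Fin h, (f k.1 (U (k.1, σ (a k.2)) ω, U (k.1, σ (a' k.2)) ω) - θ k.1)
  let c : NNReal := ⟨b ^ 2 / (Fintype.card J * h), by positivity⟩
  have hX : ∀ σ, HasSubgaussianMGF (X σ) c P := by
    intro σ
    let e : (J × Fin h) ⊕ (J × Fin h) → J × Fin m :=
      Sum.elim (fun k => (k.1, σ (a k.2))) (fun k => (k.1, σ (a' k.2)))
    have he : e.Injective := by
      rintro (⟨j, l⟩ | ⟨j, l⟩) (⟨j', l'⟩ | ⟨j', l'⟩) hk <;>
        simp only [e, Sum.elim_inl, Sum.elim_inr, Prod.mk.injEq, EmbeddingLike.apply_eq_iff_eq, a,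
          a', Fin.mk.injEq] at hk <;> obtain ⟨rfl, hk⟩ := hk
      · congr 2; exact Fin.ext (by omega)
      · omega
      · omega
      · congr 2; exact Fin.ext (by omega)
    obtain ⟨ind, law⟩ := iIndepFun_pair (Z := fun k => U (e k)) (hU.precomp he) fun k => hlaw _
    have ind' := ind.comp (fun k z => f k.1 z - θ k.1) fun k => (hf k.1).sub_const _
    have sg : ∀ k : J × Fin h, HasSubgaussianMGF
        (fun ω => f k.1 (U (e (.inl k)) ω, U (e (.inr k)) ω) - θ k.1)
        ((‖b - -b‖₊ / 2) ^ 2) P := by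
      intro k
      have mean : ∫ ω, f k.1 (U (e (.inl k)) ω, U (e (.inr k)) ω) ∂P = θ k.1 := by
        have := integral_map (law k).aemeasurable (f := f k.1) (hf k.1).aestronglyMeasurable
        rw [← this, (law k).map_eq]
      have := hasSubgaussianMGF_of_mem_Icc (μ := P) (a := -b) (b := b)
        ((hf k.1).comp_aemeasurable (law k).aemeasurable)
        (ae_of_all _ fun ω => abs_le.1 (hfb k.1 _))
      simp only [Function.comp_def] at this
      rwa [mean] at this
    have sum := (HasSubgaussianMGF.sum_of_iIndepFun (s := Finset.univ) ind'
      fun k _ => sg k).const_mul ((Fintype.card J : ℝ) * h)⁻¹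
    have hc : (⟨((Fintype.card J : ℝ) * h)⁻¹ ^ 2, sq_nonneg _⟩ : NNReal) *
        ∑ _k : J × Fin h, (‖b - -b‖₊ / 2) ^ 2 = c := by
      apply NNReal.eq
      change ((Fintype.card J : ℝ) * h)⁻¹ ^ 2 *
        ((∑ _k : J × Fin h, (‖b - -b‖₊ / 2) ^ 2 : NNReal) : ℝ) = b ^ 2 / (Fintype.card J * h)
      simp only [Finset.sum_const, Finset.card_univ, Fintype.card_prod, Fintype.card_fin,
        nsmul_eq_mul, NNReal.coe_mul, NNReal.coe_pow, NNReal.coe_div, coe_nnnorm,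
        NNReal.coe_natCast, Nat.cast_mul, NNReal.coe_ofNat]
      rw [Real.norm_of_nonneg (by linarith)]
      field_simp
      ring
    rw [← hc]; exact sum
  have tail := (hasSubgaussianMGF_average hX).measure_ge_le hε
  have eq : ∀ ω, (Fintype.card (Equiv.Perm (Fin m)) : ℝ)⁻¹ * ∑ σ, X σ ω
      = (Fintype.card J : ℝ)⁻¹ * ∑ j, (1 / ((m : ℝ) * (m - 1)) *
        ∑ r, ∑ s ∈ Finset.univ.erase r, f j (U (j, r) ω, U (j, s) ω) - θ j) := by
    intro ω
    have e1 : ∀ j (l : Fin h), (1 / ((m : ℝ) * (m - 1)) *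
        ∑ r, ∑ s ∈ Finset.univ.erase r, f j (U (j, r) ω, U (j, s) ω) - θ j)
        = (Fintype.card (Equiv.Perm (Fin m)) : ℝ)⁻¹ * ∑ σ : Equiv.Perm (Fin m),
          (f j (U (j, σ (a l)) ω, U (j, σ (a' l)) ω) - θ j) := by
      intro j l
      rw [sum_erase_eq_sum_perm (fun r s => f j (U (j, r) ω, U (j, s) ω)) (a := a l) (b := a' l)
        (by simp [a, a', Fin.ext_iff]), Finset.sum_sub_distrib, mul_sub, Finset.sum_const,
        Finset.card_univ, nsmul_eq_mul, inv_mul_cancel_left₀]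
      exact_mod_cast Fintype.card_ne_zero
    have e2 : ∀ j, (1 / ((m : ℝ) * (m - 1)) *
        ∑ r, ∑ s ∈ Finset.univ.erase r, f j (U (j, r) ω, U (j, s) ω) - θ j)
        = (h : ℝ)⁻¹ * ∑ l : Fin h, (Fintype.card (Equiv.Perm (Fin m)) : ℝ)⁻¹ *
          ∑ σ : Equiv.Perm (Fin m), (f j (U (j, σ (a l)) ω, U (j, σ (a' l)) ω) - θ j) := by
      intro j
      simp_rw [← e1 j]
      rw [Finset.sum_const, Finset.card_univ, Fintype.card_fin, nsmul_eq_mul,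
        inv_mul_cancel_left₀ hhpos.ne']
    simp_rw [e2, X, Fintype.sum_prod_type, ← Finset.mul_sum]
    rw [Finset.sum_comm]
    simp_rw [Finset.sum_comm (s := (Finset.univ : Finset (Equiv.Perm (Fin m))))]
    rw [mul_inv]; ring
  simp_rw [eq] at tail
  refine tail.trans (Real.exp_le_exp.2 ?_)
  rw [neg_div, neg_div, neg_le_neg_iff]
  change _ ≤ ε ^ 2 / (2 * (b ^ 2 / (Fintype.card J * h)))
  rw [div_le_div_iff₀ (by positivity) (by positivity)]
  have := mul_le_mul_of_nonneg_left hmh (by positivity : 0 ≤ ε ^ 2 * Fintype.card J)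
  calc ε ^ 2 * Fintype.card J * m * (2 * (b ^ 2 / (Fintype.card J * h)))
      = (ε ^ 2 * Fintype.card J * m) * (2 * b ^ 2) / (Fintype.card J * h) := by ring
    _ ≤ (ε ^ 2 * Fintype.card J * (3 * h)) * (2 * b ^ 2) / (Fintype.card J * h) := by gcongr
    _ = ε ^ 2 * (6 * b ^ 2) := by field_simp; ring

/-! ### A one-sided Bernstein inequality -/

/-- Under the variance condition `E h² ≤ 16 K E h`, the moment generating function at
`τ = ± 1 / (32 K)` is bounded by that of a constant comparable to `E h`. -/
lemma mgf_le_exp_of_integral_sq_le {S : Type*} [MeasurableSpace S] {ν : Measure S}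
    [IsProbabilityMeasure ν] {h : S → ℝ} {K τ : ℝ} (hh : Measurable h) (hK : 0 < K)
    (hb : ∀ z, |h z| ≤ 8 * K) (hvar : ∫ z, h z ^ 2 ∂ν ≤ 16 * K * ∫ z, h z ∂ν)
    (hτ : |τ| = 1 / (32 * K)) :
    mgf h ν τ ≤ Real.exp (τ * ∫ z, h z ∂ν + |τ| * (∫ z, h z ∂ν) / 2) := by
  have hi : Integrable h ν := Integrable.of_bound hh.aestronglyMeasurable (8 * K) (ae_of_all _ hb)
  have hi2 : Integrable (fun z => h z ^ 2) ν :=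
    Integrable.of_bound (hh.pow_const 2).aestronglyMeasurable ((8 * K) ^ 2)
      (ae_of_all _ fun z => by
        rw [Real.norm_eq_abs, abs_pow]; exact pow_le_pow_left₀ (abs_nonneg _) (hb z) 2)
  have hsmall : ∀ z, |τ * h z| ≤ 1 := fun z => by
    rw [abs_mul, hτ]
    calc 1 / (32 * K) * |h z| ≤ 1 / (32 * K) * (8 * K) := by gcongr; exact hb z
      _ ≤ 1 := by rw [div_mul_eq_mul_div, div_le_one (by positivity)]; linarith
  have hexp : ∀ z, Real.exp (τ * h z) ≤ 1 + τ * h z + τ ^ 2 * h z ^ 2 := fun z => by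
    have := (abs_le.1 (Real.abs_exp_sub_one_sub_id_le (hsmall z))).2
    nlinarith
  have hi3 : Integrable (fun z => Real.exp (τ * h z)) ν :=
    Integrable.of_bound (Real.measurable_exp.comp (hh.const_mul τ)).aestronglyMeasurable
      (Real.exp 1) (ae_of_all _ fun z => by
        rw [Real.norm_of_nonneg (Real.exp_pos _).le]
        exact Real.exp_le_exp.2 ((le_abs_self _).trans (hsmall z)))
  have hτ2 : τ ^ 2 * (16 * K) = |τ| / 2 := by
    rw [← sq_abs, hτ]; field_simp; norm_num
  calc mgf h ν τ ≤ ∫ z, (1 + τ * h z + τ ^ 2 * h z ^ 2) ∂ν :=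
        integral_mono hi3 (((integrable_const _).add (hi.const_mul _)).add (hi2.const_mul _)) hexp
    _ = 1 + τ * ∫ z, h z ∂ν + τ ^ 2 * ∫ z, h z ^ 2 ∂ν := by
        have i1 : Integrable (fun z => 1 + τ * h z) ν := (integrable_const _).add (hi.const_mul _)
        rw [integral_add i1 (hi2.const_mul _), integral_add (integrable_const _) (hi.const_mul _),
          integral_const_mul, integral_const_mul]
        simp
    _ ≤ 1 + τ * ∫ z, h z ∂ν + τ ^ 2 * (16 * K * ∫ z, h z ∂ν) := by gcongr
    _ = (τ * ∫ z, h z ∂ν + |τ| * (∫ z, h z ∂ν) / 2) + 1 := by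
        rw [← mul_assoc, hτ2]; ring
    _ ≤ _ := Real.add_one_le_exp _

lemma integrable_exp_mul_sum_of_bounded {S Ω : Type*} [MeasurableSpace S]
    [MeasurableSpace Ω] {P : Measure Ω} [IsFiniteMeasure P] {ν : Measure S} {n : ℕ}
    {Z : Fin n → Ω → S} {h : S → ℝ} (hlaw : ∀ i, HasLaw (Z i) ν P)
    (hh : Measurable h) {b : ℝ} (hb : ∀ z, |h z| ≤ b) (τ : ℝ) :
    Integrable (fun ω => Real.exp (τ * ∑ i, h (Z i ω))) P := by
  have hm : AEMeasurable (fun ω => ∑ i, h (Z i ω)) P :=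
    Finset.aemeasurable_fun_sum _ fun i _ => hh.comp_aemeasurable (hlaw i).aemeasurable
  refine Integrable.of_bound
    (Real.measurable_exp.comp_aemeasurable (hm.const_mul τ)).aestronglyMeasurable
    (Real.exp (|τ| * (n * b))) (ae_of_all _ fun ω => ?_)
  rw [Real.norm_of_nonneg (Real.exp_pos _).le, Real.exp_le_exp]
  refine (le_abs_self _).trans ?_
  rw [abs_mul]
  gcongr
  refine (Finset.abs_sum_le_sum_abs _ _).trans ((Finset.sum_le_sum fun i _ => hb _).trans ?_)
  simp

section Bernstein

variable {S Ω : Type*} [MeasurableSpace S] [MeasurableSpace Ω] {P : Measure Ω} {ν : Measure S}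
  [IsProbabilityMeasure ν] {n : ℕ} {Z : Fin n → Ω → S} {h : S → ℝ} {K : ℝ}

lemma mgf_sum_le_exp_of_integral_sq_le {τ : ℝ} (hZ : iIndepFun Z P)
    (hlaw : ∀ i, HasLaw (Z i) ν P) (hh : Measurable h) (hK : 0 < K) (hb : ∀ z, |h z| ≤ 8 * K)
    (hvar : ∫ z, h z ^ 2 ∂ν ≤ 16 * K * ∫ z, h z ∂ν) (hτ : |τ| = 1 / (32 * K)) :
    mgf (fun ω => ∑ i, h (Z i ω)) P τ
      ≤ Real.exp (n * (τ * ∫ z, h z ∂ν + |τ| * (∫ z, h z ∂ν) / 2)) := by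
  have hm : ∀ i, AEMeasurable (h ∘ Z i) P := fun i => hh.comp_aemeasurable (hlaw i).aemeasurable
  have h1 := (hZ.comp (fun _ => h) fun _ => hh).mgf_sum₀ (t := τ) hm Finset.univ
  have h2 : ∀ i, mgf (h ∘ Z i) P τ = mgf h ν τ := fun i => by
    rw [← (hlaw i).map_eq, mgf_map (hlaw i).aemeasurable]
    exact (Real.measurable_exp.comp (hh.const_mul τ)).aestronglyMeasurable
  have h3 : (fun ω => ∑ i, h (Z i ω)) = ∑ i, h ∘ Z i := by ext ω; simp
  rw [h3, h1]
  simp only [h2, Finset.prod_const, Finset.card_univ, Fintype.card_fin]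
  rw [Real.exp_nat_mul]
  exact pow_le_pow_left₀ mgf_nonneg (mgf_le_exp_of_integral_sq_le hh hK hb hvar hτ) n

/-- Upper deviations: with probability at least `1 - e^{-s}` the empirical mean is at most
`3/2` of the mean, up to `32 K s / n`. -/
lemma measure_sum_ge_le_of_integral_sq_le {s : ℝ} (hZ : iIndepFun Z P)
    (hlaw : ∀ i, HasLaw (Z i) ν P) (hh : Measurable h) (hK : 0 < K) (hb : ∀ z, |h z| ≤ 8 * K)
    (hvar : ∫ z, h z ^ 2 ∂ν ≤ 16 * K * ∫ z, h z ∂ν) :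
    P.real {ω | 3 / 2 * (n * ∫ z, h z ∂ν) + 32 * K * s ≤ ∑ i, h (Z i ω)} ≤ Real.exp (-s) := by
  have := hZ.isProbabilityMeasure
  have hτ0 : 0 < 1 / (32 * K) := by positivity
  refine (measure_ge_le_exp_mul_mgf _ hτ0.le
    (integrable_exp_mul_sum_of_bounded hlaw hh hb _)).trans ?_
  refine (mul_le_mul_of_nonneg_left (mgf_sum_le_exp_of_integral_sq_le hZ hlaw hh hK hb hvar
    (abs_of_pos hτ0)) (Real.exp_pos _).le).trans (le_of_eq ?_)
  rw [← Real.exp_add, abs_of_pos hτ0]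
  congr 1; field_simp; ring

/-- Lower deviations: with probability at least `1 - e^{-s}` the empirical mean is at least half
of the mean, up to `32 K s / n`. -/
lemma measure_sum_le_le_of_integral_sq_le {s : ℝ} (hZ : iIndepFun Z P)
    (hlaw : ∀ i, HasLaw (Z i) ν P) (hh : Measurable h) (hK : 0 < K) (hb : ∀ z, |h z| ≤ 8 * K)
    (hvar : ∫ z, h z ^ 2 ∂ν ≤ 16 * K * ∫ z, h z ∂ν) :
    P.real {ω | ∑ i, h (Z i ω) ≤ 1 / 2 * (n * ∫ z, h z ∂ν) - 32 * K * s} ≤ Real.exp (-s) := by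
  have := hZ.isProbabilityMeasure
  have hτ0 : 0 < 1 / (32 * K) := by positivity
  have hτ : |-(1 / (32 * K))| = 1 / (32 * K) := by rw [abs_neg, abs_of_pos hτ0]
  refine (measure_le_le_exp_mul_mgf _ (neg_nonpos.2 hτ0.le)
    (integrable_exp_mul_sum_of_bounded hlaw hh hb _)).trans ?_
  refine (mul_le_mul_of_nonneg_left (mgf_sum_le_exp_of_integral_sq_le hZ hlaw hh hK hb hvar
    hτ) (Real.exp_pos _).le).trans (le_of_eq ?_)
  rw [← Real.exp_add, hτ]
  congr 1; field_simp; ring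

end Bernstein

/-! ### Least squares in the Hilbert space -/

section Hilbert

lemma integrable_sq_norm_sub {E F : Type*} [MeasurableSpace E] [NormedAddCommGroup F]
    {ν : Measure E} [IsFiniteMeasure ν] {v w : E → F} {κ : ℝ}
    (hv : StronglyMeasurable v) (hw : StronglyMeasurable w)
    (hvκ : ∀ x, ‖v x‖ ≤ κ) (hwκ : ∀ x, ‖w x‖ ≤ κ) : Integrable (fun x => ‖v x - w x‖ ^ 2) ν := by
  refine Integrable.of_bound (((hv.sub hw).norm.pow 2).aestronglyMeasurable) ((2 * κ) ^ 2)
    (ae_of_all _ fun x => ?_)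
  rw [Real.norm_of_nonneg (sq_nonneg _)]
  refine pow_le_pow_left₀ (norm_nonneg _) ?_ 2
  linarith [norm_sub_le (v x) (w x), hvκ x, hwκ x]

variable {H : Type*} [NormedAddCommGroup H] [InnerProductSpace ℝ H]

/-- The squared loss `‖v(x) - Φ(y)‖²` of a regression function `v` with values in `H`, without
the term `‖Φ(y)‖²`, which does not depend on `v`. -/
noncomputable def sqLoss {E : Type*} (Φ : ℝ → H) (v : E → H) (z : E × ℝ) : ℝ :=
  ‖v z.1‖ ^ 2 - 2 * inner ℝ (v z.1) (Φ z.2)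

lemma sqLoss_sub_sqLoss {E : Type*} (Φ : ℝ → H) (v w : E → H) (z : E × ℝ) :
    sqLoss Φ v z - sqLoss Φ w z = inner ℝ (v z.1 - w z.1) (v z.1 + w z.1 - (2 : ℝ) • Φ z.2) := by
  simp only [sqLoss, inner_sub_left, inner_sub_right, inner_add_right, real_inner_smul_right,
    real_inner_self_eq_norm_sq]
  rw [real_inner_comm (w z.1) (v z.1)]
  ring

lemma abs_sqLoss_sub_sqLoss_le {E : Type*} {Φ : ℝ → H} {v w : E → H} {κ : ℝ}
    (hΦ : ∀ y, ‖Φ y‖ ≤ κ) (hv : ∀ x, ‖v x‖ ≤ κ) (hw : ∀ x, ‖w x‖ ≤ κ) (z : E × ℝ) :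
    |sqLoss Φ v z - sqLoss Φ w z| ≤ 4 * κ * ‖v z.1 - w z.1‖ := by
  rw [sqLoss_sub_sqLoss, mul_comm]
  refine (abs_real_inner_le_norm _ _).trans (mul_le_mul_of_nonneg_left ?_ (norm_nonneg _))
  have h1 := norm_sub_le (v z.1 + w z.1) ((2 : ℝ) • Φ z.2)
  have h2 := norm_add_le (v z.1) (w z.1)
  rw [norm_smul, Real.norm_ofNat] at h1
  linarith [hΦ z.2, hv z.1, hw z.1]

variable {E : Type*} [MeasurableSpace E]

lemma measurable_sqLoss {Φ : ℝ → H} (hΦ : Continuous Φ) {v : E → H} (hv : StronglyMeasurable v) :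
    Measurable (sqLoss Φ v) := by
  have h1 : StronglyMeasurable fun z : E × ℝ => v z.1 := hv.comp_measurable measurable_fst
  have h2 : StronglyMeasurable fun z : E × ℝ => Φ z.2 :=
    hΦ.stronglyMeasurable.comp_measurable measurable_snd
  exact ((h1.norm.pow 2).sub ((h1.inner h2).const_mul 2)).measurable

lemma norm_integral_le_of_norm_le_of_isProbabilityMeasure {ν : Measure E} [IsProbabilityMeasure ν]
    {f : E → H} {κ : ℝ} (hf : ∀ x, ‖f x‖ ≤ κ) : ‖∫ x, f x ∂ν‖ ≤ κ := by
  simpa using norm_integral_le_of_norm_le_const (μ := ν) (ae_of_all _ hf)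

/-- The regression function of `Φ(Y)` given `X = x`, as the integral of `Φ` against the regular
conditional distribution of `Y`. -/
noncomputable def condMean (Φ : ℝ → H) (μ₀ : Measure (E × ℝ)) [IsFiniteMeasure μ₀] (x : E) : H :=
  ∫ y, Φ y ∂(μ₀.condKernel x)

variable {μ₀ : Measure (E × ℝ)} [IsProbabilityMeasure μ₀] {Φ : ℝ → H} {κ : ℝ}

lemma stronglyMeasurable_condMean (hΦ : Continuous Φ) :
    StronglyMeasurable (condMean Φ μ₀) :=
  StronglyMeasurable.integral_kernel hΦ.stronglyMeasurable

lemma norm_condMean_le (hκ : ∀ y, ‖Φ y‖ ≤ κ) (x : E) : ‖condMean Φ μ₀ x‖ ≤ κ :=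
  norm_integral_le_of_norm_le_of_isProbabilityMeasure hκ

lemma abs_excess_le (hκ : ∀ y, ‖Φ y‖ ≤ κ) {v : E → H} (hvκ : ∀ x, ‖v x‖ ≤ κ) (z : E × ℝ) :
    |sqLoss Φ v z - sqLoss Φ (condMean Φ μ₀) z| ≤ 8 * κ ^ 2 := by
  have hwκ := norm_condMean_le (μ₀ := μ₀) hκ
  have hκ0 : 0 ≤ κ := (norm_nonneg _).trans (hκ 0)
  refine (abs_sqLoss_sub_sqLoss_le hκ hvκ hwκ z).trans ?_
  have := norm_sub_le (v z.1) (condMean Φ μ₀ z.1)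
  nlinarith [hvκ z.1, hwκ z.1]

variable [CompleteSpace H]

/-- The excess risk of `v` over the regression function is the squared distance between them. -/
lemma integral_sqLoss_sub_sqLoss (hΦ : Continuous Φ) (hκ : ∀ y, ‖Φ y‖ ≤ κ) {v : E → H}
    (hv : StronglyMeasurable v) (hvκ : ∀ x, ‖v x‖ ≤ κ) :
    ∫ z, (sqLoss Φ v z - sqLoss Φ (condMean Φ μ₀) z) ∂μ₀
      = ∫ x, ‖v x - condMean Φ μ₀ x‖ ^ 2 ∂μ₀.fst := by
  have hw := stronglyMeasurable_condMean (μ₀ := μ₀) hΦ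
  have hwκ := norm_condMean_le (μ₀ := μ₀) hκ
  have hκ0 : 0 ≤ κ := (norm_nonneg _).trans (hκ 0)
  rw [← Measure.integral_condKernel]
  · refine integral_congr_ae (ae_of_all _ fun x => ?_)
    have hi : Integrable Φ (μ₀.condKernel x) :=
      Integrable.of_bound hΦ.aestronglyMeasurable κ (ae_of_all _ hκ)
    simp only [sqLoss_sub_sqLoss]
    have hi2 : Integrable (fun y => (2 : ℝ) • Φ y) (μ₀.condKernel x) := hi.smul (2 : ℝ)
    have hi3 : Integrable (fun y => v x + condMean Φ μ₀ x - (2 : ℝ) • Φ y) (μ₀.condKernel x) :=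
      (integrable_const _).sub hi2
    rw [integral_inner hi3, integral_sub (integrable_const _) hi2, integral_smul, integral_const,
      probReal_univ, one_smul]
    change inner ℝ _ (v x + condMean Φ μ₀ x - (2 : ℝ) • condMean Φ μ₀ x) = _
    rw [two_smul, add_sub_add_right_eq_sub, real_inner_self_eq_norm_sq]
  · refine Integrable.of_bound
      ((measurable_sqLoss hΦ hv).sub (measurable_sqLoss hΦ hw)).aestronglyMeasurable
      (4 * κ * (2 * κ)) (ae_of_all _ fun z => ?_)
    refine (abs_sqLoss_sub_sqLoss_le hκ hvκ hwκ z).trans ?_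
    gcongr
    linarith [norm_sub_le (v z.1) (condMean Φ μ₀ z.1), hvκ z.1, hwκ z.1]

/-- The variance of the excess loss is controlled by its mean. -/
lemma integral_excess_sq_le (hΦ : Continuous Φ) (hκ : ∀ y, ‖Φ y‖ ≤ κ) {v : E → H}
    (hv : StronglyMeasurable v) (hvκ : ∀ x, ‖v x‖ ≤ κ) :
    ∫ z, (sqLoss Φ v z - sqLoss Φ (condMean Φ μ₀) z) ^ 2 ∂μ₀
      ≤ 16 * κ ^ 2 * ∫ z, (sqLoss Φ v z - sqLoss Φ (condMean Φ μ₀) z) ∂μ₀ := by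
  have hw := stronglyMeasurable_condMean (μ₀ := μ₀) hΦ
  have hwκ := norm_condMean_le (μ₀ := μ₀) hκ
  rw [integral_sqLoss_sub_sqLoss hΦ hκ hv hvκ, ← integral_const_mul]
  have hint := (integrable_sq_norm_sub (ν := μ₀.fst) hv hw hvκ hwκ).const_mul (16 * κ ^ 2)
  have hfst : ∫ x, 16 * κ ^ 2 * ‖v x - condMean Φ μ₀ x‖ ^ 2 ∂μ₀.fst
      = ∫ z, 16 * κ ^ 2 * ‖v z.1 - condMean Φ μ₀ z.1‖ ^ 2 ∂μ₀ :=
    integral_map measurable_fst.aemeasurable hint.aestronglyMeasurable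
  rw [hfst]
  refine integral_mono_of_nonneg (ae_of_all _ fun z => sq_nonneg _)
    (hint.comp_measurable measurable_fst) (ae_of_all _ fun z => ?_)
  have := pow_le_pow_left₀ (abs_nonneg _) (abs_sqLoss_sub_sqLoss_le hκ hvκ hwκ z) 2
  rw [sq_abs] at this
  linarith

end Hilbert

/-! ### The Monte Carlo error of the empirical objective -/

section MonteCarlo

variable {H : Type*} [NormedAddCommGroup H] [InnerProductSpace ℝ H] {p q : ℕ}

/-- The mean `E_U[Φ(g(x, U))]` of the generated distribution at `x`, embedded by `Φ`. -/
noncomputable def genMean (Φ : ℝ → H) (μᵤ : Measure (Fin q → ℝ))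
    (g : (Fin p → ℝ) → (Fin q → ℝ) → ℝ) (x : Fin p → ℝ) : H :=
  ∫ u, Φ (g x u) ∂μᵤ

/-- The loss of a pair of simulated noises at a data point: the kernel objective is the
U-statistic built from it. -/
noncomputable def pairLoss (Φ : ℝ → H) (g : (Fin p → ℝ) → (Fin q → ℝ) → ℝ) (x : Fin p → ℝ) (y : ℝ)
    (w : (Fin q → ℝ) × (Fin q → ℝ)) : ℝ :=
  inner ℝ (Φ (g x w.1)) (Φ (g x w.2)) - inner ℝ (Φ (g x w.1)) (Φ y)
    - inner ℝ (Φ (g x w.2)) (Φ y)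

lemma average_prod_eq {m n : ℕ} (T : Fin m → Fin n → ℝ) :
    1 / (m : ℝ) * ∑ b, 1 / (n : ℝ) * ∑ i, T b i
      = (Fintype.card (Fin m × Fin n) : ℝ)⁻¹ * ∑ j : Fin m × Fin n, T j.1 j.2 := by
  rw [Fintype.sum_prod_type, ← Finset.mul_sum]
  simp only [Fintype.card_prod, Fintype.card_fin, Nat.cast_mul, mul_inv, one_div, mul_assoc]

lemma kernelLoss_eq_uStatistic (Φ : ℝ → H) (g : (Fin p → ℝ) → (Fin q → ℝ) → ℝ) {n m₁ m₂ : ℕ}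
    (hm₂ : 2 ≤ m₂) (x : Fin n → Fin p → ℝ) (y : Fin n → ℝ)
    (u : Fin m₁ → Fin n → Fin m₂ → Fin q → ℝ) :
    kernelLoss (fun a b => inner ℝ (Φ a) (Φ b)) x y u g
      = (Fintype.card (Fin m₁ × Fin n) : ℝ)⁻¹ * ∑ j : Fin m₁ × Fin n,
        1 / ((m₂ : ℝ) * (m₂ - 1)) * ∑ r, ∑ s ∈ Finset.univ.erase r,
          pairLoss Φ g (x j.2) (y j.2) (u j.1 j.2 r, u j.1 j.2 s) := by
  have hm : (2 : ℝ) ≤ m₂ := by exact_mod_cast hm₂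
  have hm0 : (m₂ : ℝ) ≠ 0 := by linarith
  have hm1 : (m₂ : ℝ) - 1 ≠ 0 := by linarith
  have key : ∀ (a : Fin m₂ → Fin m₂ → ℝ) (c : Fin m₂ → ℝ),
      ∑ r, ∑ s ∈ Finset.univ.erase r, (a r s - c r - c s)
        = (∑ r, ∑ s ∈ Finset.univ.erase r, a r s) - 2 * ((m₂ - 1) * ∑ r, c r) := by
    intro a c
    have e1 : ∑ r, ∑ _s ∈ Finset.univ.erase r, c r = (m₂ - 1) * ∑ r, c r := by
      rw [Finset.mul_sum]
      refine Finset.sum_congr rfl fun r _ => ?_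
      rw [Finset.sum_const, Finset.card_erase_of_mem (Finset.mem_univ _), Finset.card_univ,
        Fintype.card_fin, nsmul_eq_mul, Nat.cast_sub (by omega), Nat.cast_one]
    have e2 : ∑ r : Fin m₂, ∑ s ∈ Finset.univ.erase r, c s = (m₂ - 1) * ∑ r, c r := by
      have : ∀ r : Fin m₂, ∑ s ∈ Finset.univ.erase r, c s = (∑ s, c s) - c r := fun r => by
        rw [← Finset.sum_erase_add _ _ (Finset.mem_univ r)]; ring
      simp only [this, Finset.sum_sub_distrib, Finset.sum_const, Finset.card_univ,
        Fintype.card_fin, nsmul_eq_mul]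
      ring
    simp only [Finset.sum_sub_distrib, e1, e2]
    ring
  rw [kernelLoss, ← average_prod_eq fun b i => 1 / ((m₂ : ℝ) * (m₂ - 1)) *
    ∑ r, ∑ s ∈ Finset.univ.erase r, pairLoss Φ g (x i) (y i) (u b i r, u b i s)]
  congr 1
  refine Finset.sum_congr rfl fun b _ => ?_
  congr 1
  refine Finset.sum_congr rfl fun i _ => ?_
  simp only [pairLoss, key]
  field_simp

variable {Φ : ℝ → H} {κ : ℝ} {g g' : (Fin p → ℝ) → (Fin q → ℝ) → ℝ}

lemma abs_inner_le_sq (hκ : ∀ y, ‖Φ y‖ ≤ κ) (a b : ℝ) :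
    |(inner ℝ (Φ a) (Φ b) : ℝ)| ≤ κ ^ 2 := by
  rw [sq]
  exact (abs_real_inner_le_norm _ _).trans
    (mul_le_mul (hκ a) (hκ b) (norm_nonneg _) ((norm_nonneg _).trans (hκ 0)))

lemma abs_pairLoss_le (hκ : ∀ y, ‖Φ y‖ ≤ κ) (x : Fin p → ℝ) (y : ℝ)
    (w : (Fin q → ℝ) × (Fin q → ℝ)) : |pairLoss Φ g x y w| ≤ 3 * κ ^ 2 := by
  have h1 := abs_le.1 (abs_inner_le_sq hκ (g x w.1) (g x w.2))
  have h2 := abs_le.1 (abs_inner_le_sq hκ (g x w.1) y)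
  have h3 := abs_le.1 (abs_inner_le_sq hκ (g x w.2) y)
  rw [pairLoss, abs_le]
  constructor <;> linarith

lemma abs_pairLoss_sub_le (hκ : ∀ y, ‖Φ y‖ ≤ κ) {e : ℝ} {x : Fin p → ℝ} {y : ℝ}
    {w : (Fin q → ℝ) × (Fin q → ℝ)} (h1 : ‖Φ (g x w.1) - Φ (g' x w.1)‖ ≤ e)
    (h2 : ‖Φ (g x w.2) - Φ (g' x w.2)‖ ≤ e) :
    |pairLoss Φ g x y w - pairLoss Φ g' x y w| ≤ 4 * κ * e := by
  have hκ0 : 0 ≤ κ := (norm_nonneg _).trans (hκ 0)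
  have bd : ∀ a b : H, ‖a‖ ≤ e → ‖b‖ ≤ κ → |(inner ℝ a b : ℝ)| ≤ κ * e := fun a b ha hb => by
    rw [mul_comm]
    exact (abs_real_inner_le_norm _ _).trans
      (mul_le_mul ha hb (norm_nonneg _) ((norm_nonneg _).trans ha))
  have b1 := abs_le.1 (bd _ _ h1 (hκ (g x w.2)))
  have b2 := abs_le.1 (bd _ _ h2 (hκ (g' x w.1)))
  have b3 := abs_le.1 (bd _ _ h1 (hκ y))
  have b4 := abs_le.1 (bd _ _ h2 (hκ y))
  simp only [inner_sub_left] at b1 b2 b3 b4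
  rw [real_inner_comm (Φ (g' x w.1)), real_inner_comm (Φ (g' x w.1))] at b2
  simp only [pairLoss]
  rw [abs_le]
  constructor <;> linarith

lemma abs_average_uStatistic_le {J : Type*} [Fintype J] {m : ℕ} (hm : 2 ≤ m) {c : ℝ} (hc : 0 ≤ c)
    (a : J → Fin m → Fin m → ℝ) (ha : ∀ j r s, |a j r s| ≤ c) :
    |(Fintype.card J : ℝ)⁻¹ * ∑ j, 1 / ((m : ℝ) * (m - 1)) *
      ∑ r, ∑ s ∈ Finset.univ.erase r, a j r s| ≤ c := by
  have hm' : (2 : ℝ) ≤ m := by exact_mod_cast hm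
  have hm1 : (0 : ℝ) < m - 1 := by linarith
  have h1 : ∀ j, |1 / ((m : ℝ) * (m - 1)) * ∑ r, ∑ s ∈ Finset.univ.erase r, a j r s| ≤ c := by
    intro j
    have : |∑ r, ∑ s ∈ Finset.univ.erase r, a j r s| ≤ m * ((m - 1) * c) := by
      refine (Finset.abs_sum_le_sum_abs _ _).trans ((Finset.sum_le_sum fun r _ =>
        (Finset.abs_sum_le_sum_abs _ _).trans (Finset.sum_le_sum fun s _ => ha j r s)).trans ?_)
      simp only [Finset.sum_const, Finset.card_erase_of_mem (Finset.mem_univ _), Finset.card_univ,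
        Fintype.card_fin, nsmul_eq_mul, Nat.cast_sub (by omega : 1 ≤ m), Nat.cast_one]
      exact le_rfl
    rw [abs_mul, abs_of_pos (by positivity)]
    calc _ ≤ 1 / ((m : ℝ) * (m - 1)) * (m * ((m - 1) * c)) := by gcongr
      _ = c := by field_simp
  rw [abs_mul, abs_of_nonneg (by positivity)]
  rcases isEmpty_or_nonempty J with hJ | hJ
  · simpa using hc
  have hJ' : (0 : ℝ) < Fintype.card J := by exact_mod_cast Fintype.card_pos
  calc _ ≤ (Fintype.card J : ℝ)⁻¹ * ∑ _j : J, c := by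
        gcongr
        exact (Finset.abs_sum_le_sum_abs _ _).trans (Finset.sum_le_sum fun j _ => h1 j)
    _ = c := by simp

lemma abs_kernelLoss_le (hκ : ∀ y, ‖Φ y‖ ≤ κ) {n m₁ m₂ : ℕ} (hm₂ : 2 ≤ m₂) (x : Fin n → Fin p → ℝ)
    (y : Fin n → ℝ) (u : Fin m₁ → Fin n → Fin m₂ → Fin q → ℝ) :
    |kernelLoss (fun a b => inner ℝ (Φ a) (Φ b)) x y u g| ≤ 3 * κ ^ 2 := by
  rw [kernelLoss_eq_uStatistic Φ g hm₂]
  exact abs_average_uStatistic_le hm₂ (by positivity) _ fun j r s => abs_pairLoss_le hκ _ _ _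

lemma abs_kernelLoss_sub_le (hκ : ∀ y, ‖Φ y‖ ≤ κ) {n m₁ m₂ : ℕ} (hm₂ : 2 ≤ m₂)
    {x : Fin n → Fin p → ℝ} {y : Fin n → ℝ} {u : Fin m₁ → Fin n → Fin m₂ → Fin q → ℝ} {e : ℝ}
    (he : 0 ≤ e) (h : ∀ b i r, ‖Φ (g (x i) (u b i r)) - Φ (g' (x i) (u b i r))‖ ≤ e) :
    |kernelLoss (fun a b => inner ℝ (Φ a) (Φ b)) x y u g
      - kernelLoss (fun a b => inner ℝ (Φ a) (Φ b)) x y u g'| ≤ 4 * κ * e := by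
  have hκ0 : 0 ≤ κ := (norm_nonneg _).trans (hκ 0)
  rw [kernelLoss_eq_uStatistic Φ g hm₂, kernelLoss_eq_uStatistic Φ g' hm₂, ← mul_sub,
    ← Finset.sum_sub_distrib]
  simp_rw [← mul_sub, ← Finset.sum_sub_distrib]
  exact abs_average_uStatistic_le hm₂ (by positivity)
    (fun (j : Fin m₁ × Fin n) r s => pairLoss Φ g (x j.2) (y j.2) (u j.1 j.2 r, u j.1 j.2 s)
      - pairLoss Φ g' (x j.2) (y j.2) (u j.1 j.2 r, u j.1 j.2 s))
    fun j r s => abs_pairLoss_sub_le hκ (h _ _ _) (h _ _ _)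

variable (hΦ : Continuous Φ) (hκ : ∀ y, ‖Φ y‖ ≤ κ)
  (hg : Continuous fun z : (Fin p → ℝ) × (Fin q → ℝ) => g z.1 z.2)

include hΦ hg in
lemma continuous_pairLoss :
    Continuous fun z : ((Fin p → ℝ) × ℝ) × (Fin q → ℝ) × (Fin q → ℝ) =>
      pairLoss Φ g z.1.1 z.1.2 z.2 := by
  have h1 : Continuous fun z : ((Fin p → ℝ) × ℝ) × (Fin q → ℝ) × (Fin q → ℝ) =>
      Φ (g z.1.1 z.2.1) := hΦ.comp (hg.comp (by fun_prop :
        Continuous fun z : ((Fin p → ℝ) × ℝ) × (Fin q → ℝ) × (Fin q → ℝ) => (z.1.1, z.2.1)))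
  have h2 : Continuous fun z : ((Fin p → ℝ) × ℝ) × (Fin q → ℝ) × (Fin q → ℝ) =>
      Φ (g z.1.1 z.2.2) := hΦ.comp (hg.comp (by fun_prop :
        Continuous fun z : ((Fin p → ℝ) × ℝ) × (Fin q → ℝ) × (Fin q → ℝ) => (z.1.1, z.2.2)))
  have h3 : Continuous fun z : ((Fin p → ℝ) × ℝ) × (Fin q → ℝ) × (Fin q → ℝ) => Φ z.1.2 := by
    fun_prop
  exact ((h1.inner h2).sub (h1.inner h3)).sub (h2.inner h3)

include hκ in
lemma norm_genMean_le {μᵤ : Measure (Fin q → ℝ)} [IsProbabilityMeasure μᵤ] (x : Fin p → ℝ) :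
    ‖genMean Φ μᵤ g x‖ ≤ κ :=
  norm_integral_le_of_norm_le_of_isProbabilityMeasure fun _ => hκ _

include hΦ hg in
lemma stronglyMeasurable_genMean {μᵤ : Measure (Fin q → ℝ)} [IsProbabilityMeasure μᵤ] :
    StronglyMeasurable (genMean Φ μᵤ g) :=
  StronglyMeasurable.integral_prod_right (f := fun x u => Φ (g x u))
    (hΦ.comp hg).stronglyMeasurable

include hΦ hκ hg in
/-- The pair loss is an unbiased estimator of the squared loss of the mean embedding. -/
lemma integral_pairLoss [CompleteSpace H] {μᵤ : Measure (Fin q → ℝ)} [IsProbabilityMeasure μᵤ]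
    (x : Fin p → ℝ) (y : ℝ) :
    ∫ w, pairLoss Φ g x y w ∂(μᵤ.prod μᵤ) = sqLoss Φ (genMean Φ μᵤ g) (x, y) := by
  have hi : Integrable (fun u => Φ (g x u)) μᵤ :=
    Integrable.of_bound (hΦ.comp (hg.comp (by fun_prop :
      Continuous fun u : Fin q → ℝ => (x, u)))).aestronglyMeasurable κ (ae_of_all _ fun _ => hκ _)
  have hc : Continuous fun w : (Fin q → ℝ) × (Fin q → ℝ) => pairLoss Φ g x y w :=
    (continuous_pairLoss hΦ hg).comp (by fun_prop :
      Continuous fun w : (Fin q → ℝ) × (Fin q → ℝ) => ((x, y), w))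
  rw [integral_prod _ (Integrable.of_bound hc.aestronglyMeasurable (3 * κ ^ 2)
    (ae_of_all _ fun w => abs_pairLoss_le hκ x y w))]
  have i1 : ∀ a : H, Integrable (fun u => (inner ℝ a (Φ (g x u)) : ℝ)) μᵤ :=
    fun a => hi.const_inner a
  have e1 : ∀ u, ∫ v, pairLoss Φ g x y (u, v) ∂μᵤ
      = inner ℝ (genMean Φ μᵤ g x - Φ y) (Φ (g x u)) - inner ℝ (Φ y) (genMean Φ μᵤ g x) := by
    intro u
    simp only [pairLoss]
    have i2 : Integrable (fun v => (inner ℝ (Φ (g x u)) (Φ (g x v)) : ℝ)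
        - inner ℝ (Φ (g x u)) (Φ y)) μᵤ := (i1 _).sub (integrable_const _)
    simp_rw [real_inner_comm (Φ y) (Φ (g x _))] at i2 ⊢
    rw [integral_sub i2 (i1 _), integral_sub (i1 _) (integrable_const _), integral_inner hi,
      integral_inner hi, integral_const, probReal_univ, one_smul, inner_sub_left]
    change inner ℝ (Φ (g x u)) (genMean Φ μᵤ g x) - _ - inner ℝ (Φ y) (genMean Φ μᵤ g x) = _
    rw [real_inner_comm (genMean Φ μᵤ g x)]
  simp_rw [e1]
  rw [integral_sub (i1 _) (integrable_const _), integral_inner hi, integral_const, probReal_univ,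
    one_smul]
  change inner ℝ _ (genMean Φ μᵤ g x) - _ = _
  simp only [sqLoss, inner_sub_left, real_inner_self_eq_norm_sq]
  rw [real_inner_comm (Φ y)]
  ring

/-- The empirical squared loss of the mean embedding, that is, the kernel objective after averaging
over the simulated noise. -/
noncomputable def empiricalRisk (Φ : ℝ → H) (v : (Fin p → ℝ) → H) {n : ℕ} (x : Fin n → Fin p → ℝ)
    (y : Fin n → ℝ) : ℝ :=
  (n : ℝ)⁻¹ * ∑ i, sqLoss Φ v (x i, y i)

include hΦ hκ hg in
/-- Deviation of the kernel objective from its mean over the noise, for fixed data, on either side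
(`σ = 1` or `σ = -1`). -/
lemma measure_noise_deviation_ge_le_of_fixed_data [CompleteSpace H] {μᵤ : Measure (Fin q → ℝ)}
    [IsProbabilityMeasure μᵤ] (hκ0 : 0 < κ) {Ω : Type*} [MeasurableSpace Ω] {P : Measure Ω}
    {n m₁ m₂ : ℕ} (hn : 1 ≤ n) (hm₁ : 1 ≤ m₁) (hm₂ : 2 ≤ m₂)
    {U : Fin m₁ → Fin n → Fin m₂ → Ω → Fin q → ℝ} (hlaw : ∀ b i r, HasLaw (U b i r) μᵤ P)
    (hU : iIndepFun (fun (j : Fin m₁ × Fin n × Fin m₂) ω => U j.1 j.2.1 j.2.2 ω) P)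
    {σ : ℝ} (hσ : |σ| = 1) {s : ℝ} (hs : 0 ≤ s) (x : Fin n → Fin p → ℝ) (y : Fin n → ℝ) :
    P.real {ω | κ ^ 2 * √(54 * s / (n * (m₁ * m₂))) ≤
      σ * (kernelLoss (fun a b => inner ℝ (Φ a) (Φ b)) x y (fun b i r => U b i r ω) g
        - empiricalRisk Φ (genMean Φ μᵤ g) x y)} ≤ Real.exp (-s) := by
  have : Nonempty (Fin m₁ × Fin n) := ⟨⟨0, hm₁⟩, ⟨0, hn⟩⟩
  have hn' : (1 : ℝ) ≤ n := by exact_mod_cast hn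
  have hm₁' : (1 : ℝ) ≤ m₁ := by exact_mod_cast hm₁
  have hm₂' : (2 : ℝ) ≤ m₂ := by exact_mod_cast hm₂
  have ind := hU.precomp (Equiv.prodAssoc (Fin m₁) (Fin n) (Fin m₂)).injective
  have tail := measure_uStatistic_ge_le (J := Fin m₁ × Fin n) (P := P) (μ := μᵤ) hm₂ ind
    (fun k => hlaw _ _ _) (f := fun j w => σ * pairLoss Φ g (x j.2) (y j.2) w)
    (fun j => (((continuous_pairLoss hΦ hg).comp (by fun_prop :
      Continuous fun w : (Fin q → ℝ) × (Fin q → ℝ) => ((x j.2, y j.2), w))).measurable).const_mul σ)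
    (b := 3 * κ ^ 2) (by positivity)
    (fun j w => by rw [abs_mul, hσ, one_mul]; exact abs_pairLoss_le hκ _ _ _)
    (ε := κ ^ 2 * √(54 * s / (n * (m₁ * m₂)))) (by positivity)
  have e1 : ∀ ω, σ * (kernelLoss (fun a b => inner ℝ (Φ a) (Φ b)) x y (fun b i r => U b i r ω) g
        - empiricalRisk Φ (genMean Φ μᵤ g) x y)
      = (Fintype.card (Fin m₁ × Fin n) : ℝ)⁻¹ * ∑ j : Fin m₁ × Fin n,
        (1 / ((m₂ : ℝ) * (m₂ - 1)) * ∑ r, ∑ s ∈ Finset.univ.erase r,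
          σ * pairLoss Φ g (x j.2) (y j.2) (U j.1 j.2 r ω, U j.1 j.2 s ω)
          - ∫ w, σ * pairLoss Φ g (x j.2) (y j.2) w ∂(μᵤ.prod μᵤ)) := by
    intro ω
    rw [kernelLoss_eq_uStatistic Φ g hm₂]
    have term : ∀ j : Fin m₁ × Fin n, 1 / ((m₂ : ℝ) * (m₂ - 1)) * ∑ r, ∑ s ∈ Finset.univ.erase r,
          σ * pairLoss Φ g (x j.2) (y j.2) (U j.1 j.2 r ω, U j.1 j.2 s ω)
          - ∫ w, σ * pairLoss Φ g (x j.2) (y j.2) w ∂(μᵤ.prod μᵤ)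
        = σ * (1 / ((m₂ : ℝ) * (m₂ - 1)) * ∑ r, ∑ s ∈ Finset.univ.erase r,
          pairLoss Φ g (x j.2) (y j.2) (U j.1 j.2 r ω, U j.1 j.2 s ω)
          - sqLoss Φ (genMean Φ μᵤ g) (x j.2, y j.2)) := by
      intro j
      rw [integral_const_mul, integral_pairLoss hΦ hκ hg]
      simp_rw [← Finset.mul_sum]
      ring
    rw [Finset.sum_congr rfl fun j _ => term j, ← Finset.mul_sum _ _ σ,
      mul_left_comm _ σ, Finset.sum_sub_distrib, mul_sub _ (∑ j, _),
      ← average_prod_eq fun _ i => sqLoss Φ (genMean Φ μᵤ g) (x i, y i), empiricalRisk]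
    congr 2
    simp only [Finset.sum_const, Finset.card_univ, Fintype.card_fin, nsmul_eq_mul]
    field_simp
  simp_rw [e1]
  refine tail.trans (Real.exp_le_exp.2 (le_of_eq ?_))
  rw [mul_pow, Real.sq_sqrt (by positivity)]
  simp only [Fintype.card_prod, Fintype.card_fin, Nat.cast_mul]
  field_simp
  ring

/-- A bound on the probability of an event that holds for every fixed value of one of two
independent variables holds unconditionally. -/
lemma measureReal_le_of_forall_section {Ω 𝓓 𝓝 : Type*} [MeasurableSpace Ω] [MeasurableSpace 𝓓]
    [MeasurableSpace 𝓝] {P : Measure Ω} [IsProbabilityMeasure P] {D : Ω → 𝓓} {V : Ω → 𝓝}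
    (hD : AEMeasurable D P) (hV : AEMeasurable V P) (hDV : IndepFun D V P) {A : Set (𝓓 × 𝓝)}
    (hA : MeasurableSet A) {c : ℝ} (h : ∀ d, P.real {ω | (d, V ω) ∈ A} ≤ c) :
    P.real {ω | (D ω, V ω) ∈ A} ≤ c := by
  obtain ⟨ω₀⟩ := P.nonempty_of_neZero
  have hc : 0 ≤ c := measureReal_nonneg.trans (h (D ω₀))
  have := Measure.isProbabilityMeasure_map hD
  have := Measure.isProbabilityMeasure_map hV
  have h1 : P {ω | (D ω, V ω) ∈ A} = (P.map D).prod (P.map V) A := by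
    rw [← (indepFun_iff_map_prod_eq_prod_map_map hD hV).1 hDV,
      Measure.map_apply_of_aemeasurable (hD.prodMk hV) hA]
    rfl
  refine ENNReal.toReal_le_of_le_ofReal hc ?_
  rw [h1, Measure.prod_apply hA]
  calc ∫⁻ d, P.map V (Prod.mk d ⁻¹' A) ∂(P.map D) ≤ ∫⁻ _d, ENNReal.ofReal c ∂(P.map D) := by
        refine lintegral_mono fun d => ?_
        rw [Measure.map_apply_of_aemeasurable hV (measurable_prodMk_left hA)]
        exact (ENNReal.le_ofReal_iff_toReal_le (measure_ne_top _ _) hc).2 (h d)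
    _ = ENNReal.ofReal c := by simp

include hΦ hκ hg in
/-- Deviation of the kernel objective from its mean over the noise, on either side. -/
lemma measure_noise_deviation_ge_le [CompleteSpace H] {μ₀ : Measure ((Fin p → ℝ) × ℝ)}
    {μᵤ : Measure (Fin q → ℝ)} [IsProbabilityMeasure μᵤ] (hκ0 : 0 < κ) {Ω : Type*}
    [MeasurableSpace Ω] {P : Measure Ω} [IsProbabilityMeasure P] {n m₁ m₂ : ℕ} (hn : 1 ≤ n)
    (hm₁ : 1 ≤ m₁) (hm₂ : 2 ≤ m₂) {X : Fin n → Ω → Fin p → ℝ} {Y : Fin n → Ω → ℝ}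
    {U : Fin m₁ → Fin n → Fin m₂ → Ω → Fin q → ℝ} (hS : IsSample P μ₀ μᵤ X Y U)
    {σ : ℝ} (hσ : |σ| = 1) {s : ℝ} (hs : 0 ≤ s) :
    P.real {ω | κ ^ 2 * √(54 * s / (n * (m₁ * m₂))) ≤
      σ * (kernelLoss (fun a b => inner ℝ (Φ a) (Φ b)) (fun i => X i ω) (fun i => Y i ω)
          (fun b i r => U b i r ω) g
        - empiricalRisk Φ (genMean Φ μᵤ g) (fun i => X i ω) (fun i => Y i ω))}
      ≤ Real.exp (-s) := by
  let A : Set ((Fin n → (Fin p → ℝ) × ℝ) × (Fin m₁ → Fin n → Fin m₂ → Fin q → ℝ)) :=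
    {z | κ ^ 2 * √(54 * s / (n * (m₁ * m₂))) ≤
      σ * (kernelLoss (fun a b => inner ℝ (Φ a) (Φ b)) (fun i => (z.1 i).1) (fun i => (z.1 i).2) z.2 g
        - empiricalRisk Φ (genMean Φ μᵤ g) (fun i => (z.1 i).1) (fun i => (z.1 i).2))}
  have hA : MeasurableSet A := by
    refine measurableSet_le measurable_const (Measurable.const_mul (Measurable.sub ?_ ?_) σ)
    · simp_rw [kernelLoss_eq_uStatistic Φ g hm₂]
      refine (Finset.measurable_fun_sum _ fun j _ => Measurable.const_mul
        (Finset.measurable_fun_sum _ fun r _ => Finset.measurable_fun_sum _ fun s _ => ?_) _).const_mul _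
      exact (continuous_pairLoss hΦ hg).measurable.comp (by fun_prop :
        Measurable fun z : (Fin n → (Fin p → ℝ) × ℝ) × (Fin m₁ → Fin n → Fin m₂ → Fin q → ℝ) =>
          (((z.1 j.2).1, (z.1 j.2).2), (z.2 j.1 j.2 r, z.2 j.1 j.2 s)))
    · refine (Finset.measurable_fun_sum _ fun i _ => ?_).const_mul _
      exact (measurable_sqLoss hΦ (stronglyMeasurable_genMean hΦ hg)).comp (by fun_prop :
        Measurable fun z : (Fin n → (Fin p → ℝ) × ℝ) × (Fin m₁ → Fin n → Fin m₂ → Fin q → ℝ) =>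
          ((z.1 i).1, (z.1 i).2))
  exact measureReal_le_of_forall_section (A := A)
    (aemeasurable_pi_lambda _ fun i => (hS.law_data i).aemeasurable)
    (aemeasurable_pi_lambda _ fun b => aemeasurable_pi_lambda _ fun i =>
      aemeasurable_pi_lambda _ fun r => (hS.law_noise b i r).aemeasurable)
    hS.indep_data_noise hA fun d =>
      measure_noise_deviation_ge_le_of_fixed_data hΦ hκ hg hκ0 hn hm₁ hm₂ hS.law_noise
        hS.indep_noise hσ hs (fun i => (d i).1) (fun i => (d i).2)

end MonteCarlo

/-! ### Uniform concentration over a finite family -/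

section Concentration

variable {H : Type*} [NormedAddCommGroup H] [InnerProductSpace ℝ H] {p q : ℕ}

/-- The squared `L²` distance between the mean embedding of `g` and the regression function. -/
noncomputable def sqError (Φ : ℝ → H) (μ₀ : Measure ((Fin p → ℝ) × ℝ)) [IsFiniteMeasure μ₀]
    (μᵤ : Measure (Fin q → ℝ)) (g : (Fin p → ℝ) → (Fin q → ℝ) → ℝ) : ℝ :=
  ∫ x, ‖genMean Φ μᵤ g x - condMean Φ μ₀ x‖ ^ 2 ∂μ₀.fst

variable {Φ : ℝ → H} {κ : ℝ} {μ₀ : Measure ((Fin p → ℝ) × ℝ)}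
  [IsProbabilityMeasure μ₀] {μᵤ : Measure (Fin q → ℝ)} [IsProbabilityMeasure μᵤ]

/-- Two generators whose embeddings are uniformly close have nearly the same error. -/
lemma sqError_le_add (hΦ : Continuous Φ) (hκ : ∀ y, ‖Φ y‖ ≤ κ)
    {g g' : (Fin p → ℝ) → (Fin q → ℝ) → ℝ}
    (hg : Continuous fun z : (Fin p → ℝ) × (Fin q → ℝ) => g z.1 z.2)
    (hg' : Continuous fun z : (Fin p → ℝ) × (Fin q → ℝ) => g' z.1 z.2) {e : ℝ} (he : 0 ≤ e)
    (h : ∀ᵐ x ∂μ₀.fst, ∀ᵐ u ∂μᵤ, ‖Φ (g x u) - Φ (g' x u)‖ ≤ e) :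
    sqError Φ μ₀ μᵤ g ≤ sqError Φ μ₀ μᵤ g' + 4 * κ * e := by
  have hw := stronglyMeasurable_condMean (μ₀ := μ₀) hΦ
  have hwκ := norm_condMean_le (μ₀ := μ₀) hκ
  have hi : ∀ {f : (Fin p → ℝ) → (Fin q → ℝ) → ℝ},
      (Continuous fun z : (Fin p → ℝ) × (Fin q → ℝ) => f z.1 z.2) →
      ∀ x, Integrable (fun u => Φ (f x u)) μᵤ := fun {f} hf x =>
    Integrable.of_bound (hΦ.comp (hf.comp (by fun_prop :
      Continuous fun u : Fin q → ℝ => (x, u)))).aestronglyMeasurable κ (ae_of_all _ fun _ => hκ _)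
  have i1 := integrable_sq_norm_sub (ν := μ₀.fst) (stronglyMeasurable_genMean hΦ hg (μᵤ := μᵤ)) hw
    (norm_genMean_le hκ) hwκ
  have i2 := integrable_sq_norm_sub (ν := μ₀.fst) (stronglyMeasurable_genMean hΦ hg' (μᵤ := μᵤ)) hw
    (norm_genMean_le hκ) hwκ
  have key : ∀ᵐ x ∂μ₀.fst, ‖genMean Φ μᵤ g x - condMean Φ μ₀ x‖ ^ 2
      ≤ ‖genMean Φ μᵤ g' x - condMean Φ μ₀ x‖ ^ 2 + 4 * κ * e := by
    filter_upwards [h] with x hx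
    have h1 : ‖genMean Φ μᵤ g x - genMean Φ μᵤ g' x‖ ≤ e := by
      rw [genMean, genMean, ← integral_sub (hi hg x) (hi hg' x)]
      simpa using norm_integral_le_of_norm_le_const hx
    set a := genMean Φ μᵤ g x - condMean Φ μ₀ x
    set b := genMean Φ μᵤ g' x - condMean Φ μ₀ x
    have h2 : ‖a‖ - ‖b‖ ≤ e := by
      refine (norm_sub_norm_le a b).trans ?_
      simpa [a, b] using h1
    have h3 : ‖a‖ ≤ 2 * κ := by
      have := norm_sub_le (genMean Φ μᵤ g x) (condMean Φ μ₀ x)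
      linarith [hwκ x, norm_genMean_le (g := g) (μᵤ := μᵤ) hκ x]
    have h4 : ‖b‖ ≤ 2 * κ := by
      have := norm_sub_le (genMean Φ μᵤ g' x) (condMean Φ μ₀ x)
      linarith [hwκ x, norm_genMean_le (g := g') (μᵤ := μᵤ) hκ x]
    have h5 : (‖a‖ - ‖b‖) * (‖a‖ + ‖b‖) ≤ e * (‖a‖ + ‖b‖) :=
      mul_le_mul_of_nonneg_right h2 (by positivity)
    have h6 : e * (‖a‖ + ‖b‖) ≤ e * (4 * κ) := mul_le_mul_of_nonneg_left (by linarith) he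
    linarith
  have i3 : Integrable (fun x => ‖genMean Φ μᵤ g' x - condMean Φ μ₀ x‖ ^ 2 + 4 * κ * e) μ₀.fst :=
    i2.add (integrable_const _)
  refine (integral_mono_ae i1 i3 key).trans (le_of_eq ?_)
  rw [integral_add i2 (integrable_const _)]
  simp [sqError]

/-- Outside an event of probability `4 e^{-t}`, all the deviation bounds needed hold: those in one
direction for all members of a finite family `T`, those in the other direction for one function `g₀`.
The bounds for the data localize (the deviation of the excess risk is a fraction of its mean, plus a
term of order `1 / n`), those for the noise do not. -/
lemma exists_event_deviation_le [CompleteSpace H] (hΦ : Continuous Φ) (hκ : ∀ y, ‖Φ y‖ ≤ κ)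
    (hκ0 : 0 < κ) {Ω : Type*} [MeasurableSpace Ω] {P : Measure Ω} [IsProbabilityMeasure P] {n m₁ m₂ : ℕ}
    (hn : 1 ≤ n) (hm₁ : 1 ≤ m₁) (hm₂ : 2 ≤ m₂) {X : Fin n → Ω → Fin p → ℝ} {Y : Fin n → Ω → ℝ}
    {U : Fin m₁ → Fin n → Fin m₂ → Ω → Fin q → ℝ} (hS : IsSample P μ₀ μᵤ X Y U)
    {T : Finset ((Fin p → ℝ) → (Fin q → ℝ) → ℝ)} (hT : T.Nonempty)
    (hTc : ∀ g ∈ T, Continuous fun z : (Fin p → ℝ) × (Fin q → ℝ) => g z.1 z.2)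
    {g₀ : (Fin p → ℝ) → (Fin q → ℝ) → ℝ}
    (hg₀ : Continuous fun z : (Fin p → ℝ) × (Fin q → ℝ) => g₀ z.1 z.2) {t s : ℝ} (ht : 0 ≤ t)
    (hs : s = t + Real.log T.card) :
    ∃ Bad : Set Ω, P.real Bad ≤ 4 * Real.exp (-t) ∧ ∀ ω ∉ Bad,
      (∀ g ∈ T,
        1 / 2 * sqError Φ μ₀ μᵤ g - 32 * κ ^ 2 * s / n
          ≤ empiricalRisk Φ (genMean Φ μᵤ g) (fun i => X i ω) (fun i => Y i ω)
            - empiricalRisk Φ (condMean Φ μ₀) (fun i => X i ω) (fun i => Y i ω) ∧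
        empiricalRisk Φ (genMean Φ μᵤ g) (fun i => X i ω) (fun i => Y i ω)
          ≤ kernelLoss (fun a b => inner ℝ (Φ a) (Φ b)) (fun i => X i ω) (fun i => Y i ω)
            (fun b i r => U b i r ω) g + κ ^ 2 * √(54 * s / (n * (m₁ * m₂)))) ∧
      kernelLoss (fun a b => inner ℝ (Φ a) (Φ b)) (fun i => X i ω) (fun i => Y i ω)
          (fun b i r => U b i r ω) g₀
        ≤ empiricalRisk Φ (genMean Φ μᵤ g₀) (fun i => X i ω) (fun i => Y i ω)
          + κ ^ 2 * √(54 * s / (n * (m₁ * m₂))) ∧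
      empiricalRisk Φ (genMean Φ μᵤ g₀) (fun i => X i ω) (fun i => Y i ω)
          - empiricalRisk Φ (condMean Φ μ₀) (fun i => X i ω) (fun i => Y i ω)
        ≤ 3 / 2 * sqError Φ μ₀ μᵤ g₀ + 32 * κ ^ 2 * s / n := by
  have hcard : (1 : ℝ) ≤ T.card := by exact_mod_cast hT.card_pos
  have hlog : 0 ≤ Real.log T.card := Real.log_nonneg hcard
  have hs0 : 0 ≤ s := by linarith
  have hn0 : (0 : ℝ) < n := by exact_mod_cast hn
  have hexp : T.card * Real.exp (-s) = Real.exp (-t) := by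
    rw [hs, neg_add, Real.exp_add, Real.exp_neg (Real.log _), Real.exp_log (by linarith)]
    field_simp
  have hexp' : Real.exp (-s) ≤ Real.exp (-t) := Real.exp_le_exp.2 (by linarith)
  -- the excess loss, to which the Bernstein inequality is applied
  let h : ((Fin p → ℝ) → (Fin q → ℝ) → ℝ) → (Fin p → ℝ) × ℝ → ℝ := fun g z =>
    sqLoss Φ (genMean Φ μᵤ g) z - sqLoss Φ (condMean Φ μ₀) z
  have hmean : ∀ g, (Continuous fun z : (Fin p → ℝ) × (Fin q → ℝ) => g z.1 z.2) →
      ∫ z, h g z ∂μ₀ = sqError Φ μ₀ μᵤ g := fun g hg =>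
    integral_sqLoss_sub_sqLoss hΦ hκ (stronglyMeasurable_genMean hΦ hg) (norm_genMean_le hκ)
  have hmeas : ∀ g, (Continuous fun z : (Fin p → ℝ) × (Fin q → ℝ) => g z.1 z.2) →
      Measurable (h g) := fun g hg =>
    (measurable_sqLoss hΦ (stronglyMeasurable_genMean hΦ hg)).sub
      (measurable_sqLoss hΦ (stronglyMeasurable_condMean hΦ))
  have hbd : ∀ g z, |h g z| ≤ 8 * κ ^ 2 := fun g z => abs_excess_le hκ (norm_genMean_le hκ) z
  have hvar : ∀ g, (Continuous fun z : (Fin p → ℝ) × (Fin q → ℝ) => g z.1 z.2) →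
      ∫ z, h g z ^ 2 ∂μ₀ ≤ 16 * κ ^ 2 * ∫ z, h g z ∂μ₀ := fun g hg =>
    integral_excess_sq_le hΦ hκ (stronglyMeasurable_genMean hΦ hg) (norm_genMean_le hκ)
  have hemp : ∀ g ω, empiricalRisk Φ (genMean Φ μᵤ g) (fun i => X i ω) (fun i => Y i ω)
      - empiricalRisk Φ (condMean Φ μ₀) (fun i => X i ω) (fun i => Y i ω)
      = (n : ℝ)⁻¹ * ∑ i, h g (X i ω, Y i ω) := fun g ω => by
    simp only [empiricalRisk, h, Finset.sum_sub_distrib, mul_sub]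
  set D : ℝ := κ ^ 2 * √(54 * s / (n * (m₁ * m₂))) with hD
  let dev : ((Fin p → ℝ) → (Fin q → ℝ) → ℝ) → Ω → ℝ := fun g ω =>
    kernelLoss (fun a b => inner ℝ (Φ a) (Φ b)) (fun i => X i ω) (fun i => Y i ω)
          (fun b i r => U b i r ω) g
        - empiricalRisk Φ (genMean Φ μᵤ g) (fun i => X i ω) (fun i => Y i ω)
  let A₁ := ⋃ g ∈ T, {ω | ∑ i, h g (X i ω, Y i ω)
    ≤ 1 / 2 * (n * ∫ z, h g z ∂μ₀) - 32 * κ ^ 2 * s}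
  let A₂ := ⋃ g ∈ T, {ω | D ≤ (-1) * dev g ω}
  let A₃ := {ω | D ≤ 1 * dev g₀ ω}
  let A₄ := {ω | 3 / 2 * (n * ∫ z, h g₀ z ∂μ₀) + 32 * κ ^ 2 * s ≤ ∑ i, h g₀ (X i ω, Y i ω)}
  have union : ∀ A : ((Fin p → ℝ) → (Fin q → ℝ) → ℝ) → Set Ω,
      (∀ g ∈ T, P.real (A g) ≤ Real.exp (-s)) → P.real (⋃ g ∈ T, A g) ≤ Real.exp (-t) := by
    intro A hA
    refine (measureReal_biUnion_finset_le _ _).trans ((Finset.sum_le_sum hA).trans ?_)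
    rw [Finset.sum_const, nsmul_eq_mul, hexp]
  have h1 : P.real A₁ ≤ Real.exp (-t) := union _ fun g hg =>
    measure_sum_le_le_of_integral_sq_le hS.indep_data hS.law_data (hmeas g (hTc g hg))
      (by positivity) (hbd g) (hvar g (hTc g hg))
  have h2 : P.real A₂ ≤ Real.exp (-t) := union _ fun g hg =>
    measure_noise_deviation_ge_le hΦ hκ (hTc g hg) hκ0 hn hm₁ hm₂ hS (by simp) hs0
  have h3 : P.real A₃ ≤ Real.exp (-t) :=
    (measure_noise_deviation_ge_le hΦ hκ hg₀ hκ0 hn hm₁ hm₂ hS (by simp) hs0).trans hexp'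
  have h4 : P.real A₄ ≤ Real.exp (-t) :=
    (measure_sum_ge_le_of_integral_sq_le hS.indep_data hS.law_data (hmeas g₀ hg₀)
      (by positivity) (hbd g₀) (hvar g₀ hg₀)).trans hexp'
  refine ⟨(A₁ ∪ A₂) ∪ (A₃ ∪ A₄), ?_, ?_⟩
  · have u1 := measureReal_union_le (μ := P) (A₁ ∪ A₂) (A₃ ∪ A₄)
    have u2 := measureReal_union_le (μ := P) A₁ A₂
    have u3 := measureReal_union_le (μ := P) A₃ A₄
    linarith
  · intro ω hω
    simp only [Set.mem_union, not_or, A₁, A₂, A₃, A₄, Set.mem_iUnion, not_exists,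
      Set.mem_ofPred_eq, not_le] at hω
    obtain ⟨⟨o1, o2⟩, o3, o4⟩ := hω
    refine ⟨fun g hg => ⟨?_, ?_⟩, ?_, ?_⟩
    · have := o1 g hg
      rw [hmean g (hTc g hg)] at this
      rw [hemp, ← div_eq_inv_mul, le_div_iff₀ hn0, sub_mul, div_mul_cancel₀ _ hn0.ne']
      linarith
    · have := o2 g hg
      simp only [dev] at this
      linarith
    · simp only [dev] at o3
      linarith
    · rw [hmean g₀ hg₀] at o4
      rw [hemp, ← div_eq_inv_mul, div_le_iff₀ hn0, add_mul, div_mul_cancel₀ _ hn0.ne']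
      linarith

end Concentration

/-! ### The feature map of the kernel -/

section Feature

variable {H : Type*} [NormedAddCommGroup H] [InnerProductSpace ℝ H] [CompleteSpace H]
  [RKHS ℝ H ℝ ℝ]

lemma inner_featureMap {k : ℝ → ℝ → ℝ} (hk : HasKernel H k) (y y' : ℝ) :
    inner ℝ (featureMap H y) (featureMap H y') = k y y' := by
  have := RKHS.kernel_inner H y y' (1 : ℝ) (1 : ℝ)
  rw [hk y y'] at this
  rw [real_inner_comm]
  simpa [featureMap] using this.symm

/-- The feature map, made constant outside `[-M, M]`, so that it is continuous and bounded on all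
of `ℝ` although the kernel is only controlled on `[-M, M]`. -/
noncomputable def clampedFeatureMap (H : Type*) [NormedAddCommGroup H] [InnerProductSpace ℝ H]
    [CompleteSpace H] [RKHS ℝ H ℝ ℝ] (M y : ℝ) : H :=
  featureMap H (max (-M) (min y M))

lemma clampedFeatureMap_eq {M y : ℝ} (hy : y ∈ Set.Icc (-M) M) :
    clampedFeatureMap H M y = featureMap H y := by
  rw [clampedFeatureMap, min_eq_left hy.2, max_eq_right hy.1]

lemma max_min_mem_Icc {M : ℝ} (hM : 0 < M) (y : ℝ) : max (-M) (min y M) ∈ Set.Icc (-M) M :=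
  ⟨le_max_left _ _, max_le (by linarith) (min_le_right _ _)⟩

lemma norm_clampedFeatureMap_le {k : ℝ → ℝ → ℝ} (hk : HasKernel H k) {M κ : ℝ} (hM : 0 < M)
    (hκ : 0 ≤ κ) (hb : ∀ y ∈ Set.Icc (-M) M, k y y ≤ κ ^ 2) (y : ℝ) :
    ‖clampedFeatureMap H M y‖ ≤ κ := by
  refine le_of_sq_le_sq ?_ hκ
  rw [← real_inner_self_eq_norm_sq, clampedFeatureMap, inner_featureMap hk]
  exact hb _ (max_min_mem_Icc hM y)

lemma continuous_clampedFeatureMap {M Lk : ℝ} (hM : 0 < M)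
    (hL : ∀ y ∈ Set.Icc (-M) M, ∀ y' ∈ Set.Icc (-M) M,
      ‖featureMap H y - featureMap H y'‖ ^ 2 ≤ Lk * |y - y'|) :
    Continuous (clampedFeatureMap H M) := by
  rw [continuous_iff_continuousAt]
  intro y
  rw [ContinuousAt, tendsto_iff_norm_sub_tendsto_zero]
  have h1 : ∀ z, ‖clampedFeatureMap H M z - clampedFeatureMap H M y‖
      ≤ √(Lk * |max (-M) (min z M) - max (-M) (min y M)|) := fun z =>
    Real.le_sqrt_of_sq_le (hL _ (max_min_mem_Icc hM z) _ (max_min_mem_Icc hM y))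
  refine squeeze_zero (fun _ => norm_nonneg _) h1 ?_
  have hc : Continuous fun z : ℝ => √(Lk * |max (-M) (min z M) - max (-M) (min y M)|) := by
    fun_prop
  simpa using hc.tendsto y

lemma kernelLoss_eq_clamped {k : ℝ → ℝ → ℝ} (hk : HasKernel H k) {M : ℝ} {p q n m₁ m₂ : ℕ}
    {x : Fin n → Fin p → ℝ} {y : Fin n → ℝ} (hy : ∀ i, y i ∈ Set.Icc (-M) M)
    (u : Fin m₁ → Fin n → Fin m₂ → Fin q → ℝ) {g : (Fin p → ℝ) → (Fin q → ℝ) → ℝ}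
    (hg : ∀ x u, g x u ∈ Set.Icc (-M) M) :
    kernelLoss k x y u g = kernelLoss (fun a b =>
      inner ℝ (clampedFeatureMap H M a) (clampedFeatureMap H M b)) x y u g := by
  simp only [kernelLoss, clampedFeatureMap_eq (hg _ _), clampedFeatureMap_eq (hy _),
    inner_featureMap hk]

lemma embeddingError_eq_sqError {M : ℝ} {p q : ℕ} {μ₀ : Measure ((Fin p → ℝ) × ℝ)}
    [IsProbabilityMeasure μ₀] (hY : ∀ᵐ z ∂μ₀, |z.2| ≤ M) (μᵤ : Measure (Fin q → ℝ))
    {g : (Fin p → ℝ) → (Fin q → ℝ) → ℝ} (hg : ∀ x u, g x u ∈ Set.Icc (-M) M) :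
    embeddingError H μ₀ μᵤ g = sqError (clampedFeatureMap H M) μ₀ μᵤ g := by
  have h1 : ∀ᵐ x ∂μ₀.fst, ∀ᵐ y ∂(μ₀.condKernel x), |y| ≤ M := by
    have h2 := hY
    rw [← μ₀.disintegrate μ₀.condKernel] at h2
    exact Measure.ae_ae_of_ae_compProd h2
  refine integral_congr_ae ?_
  filter_upwards [h1] with x hx
  have e1 : genEmbedding H μᵤ g x = genMean (clampedFeatureMap H M) μᵤ g x := by
    simp only [genEmbedding, genMean, clampedFeatureMap_eq (hg _ _)]
  have e2 : targetEmbedding H μ₀ x = condMean (clampedFeatureMap H M) μ₀ x := by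
    refine integral_congr_ae ?_
    filter_upwards [hx] with y hy
    rw [clampedFeatureMap_eq (abs_le.1 hy)]
  rw [e1, e2]

end Feature

/-! ### The oracle inequality -/

/-- The confidence parameter of the union bound over the net is of the order of the squared
statistical error. -/
lemma add_div_le_statError_sq {N L n : ℕ} {A t ℓ : ℝ} (hA : 1 ≤ A) (hn : 3 ≤ n) (ht : 0 < t)
    (hℓ : ℓ ≤ A * ((N : ℝ) ^ 2 * L ^ 2 * Real.log n)) :
    (t + ℓ) / n ≤ A * statError N L n t ^ 2 := by
  have hn' : (3 : ℝ) ≤ n := by exact_mod_cast hn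
  have hl : 0 ≤ Real.log n := Real.log_nonneg (by linarith)
  have h1 : statError N L n t ^ 2 ≥ (N : ℝ) ^ 2 * L ^ 2 * (Real.log n / n) + t / n := by
    have e1 := Real.sq_sqrt (div_nonneg hl (by linarith : (0 : ℝ) ≤ n))
    have e2 := Real.sq_sqrt (div_nonneg ht.le (by linarith : (0 : ℝ) ≤ n))
    have e3 : 0 ≤ ((N : ℝ) * L * √(Real.log n / n)) * √(t / n) := by positivity
    rw [statError, add_sq, mul_pow, mul_pow, e1, e2]
    linarith
  have h2 : (t + ℓ) / n ≤ A * ((N : ℝ) ^ 2 * L ^ 2 * (Real.log n / n) + t / n) := by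
    have e : A * ((N : ℝ) ^ 2 * L ^ 2 * (Real.log n / n) + t / n)
        = (A * ((N : ℝ) ^ 2 * L ^ 2 * Real.log n) + A * t) / n := by ring
    have hAt : t ≤ A * t := le_mul_of_one_le_left ht.le hA
    rw [e]
    exact div_le_div_of_nonneg_right (by linarith) (by linarith)
  exact h2.trans (mul_le_mul_of_nonneg_left h1 (by linarith))

lemma one_div_le_statError_sq {N L n : ℕ} {t : ℝ} (hN : 1 ≤ N) (hL : 1 ≤ L) (hn : 3 ≤ n) :
    1 / (n : ℝ) ≤ statError N L n t ^ 2 := by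
  have hn' : (3 : ℝ) ≤ n := by exact_mod_cast hn
  have hN' : (1 : ℝ) ≤ N := by exact_mod_cast hN
  have hL' : (1 : ℝ) ≤ L := by exact_mod_cast hL
  have hl : 1 ≤ Real.log n := by
    rw [Real.le_log_iff_exp_le (by linarith)]
    exact (Real.exp_one_lt_d9.le.trans (by norm_num)).trans hn'
  have h1 : √(1 / n) ≤ statError N L n t := by
    have e1 : √(1 / (n : ℝ)) ≤ √(Real.log n / n) := by gcongr
    have e2 : 1 * √(Real.log n / n) ≤ (N : ℝ) * L * √(Real.log n / n) := by
      gcongr; exact one_le_mul_of_one_le_of_one_le hN' hL'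
    have e3 : 0 ≤ √(t / n) := Real.sqrt_nonneg _
    unfold statError
    linarith
  calc 1 / (n : ℝ) = √(1 / n) ^ 2 := (Real.sq_sqrt (by positivity)).symm
    _ ≤ _ := pow_le_pow_left₀ (Real.sqrt_nonneg _) h1 2

/-- Oracle inequality for kernel distributional regression. The constant `C` depends only on the
size `c₀` of the covariate domain, on the level `M` bounding `Y` and the networks, on the constant
`c₁` in `log B ≤ c₁ log n`, `log (N L) ≤ c₁ log n`, and on an upper bound `ρ` for the ratio
`Lₖ / κ²` of the two constants of the kernel. -/
theorem mainTheorem8 (c₀ M c₁ ρ : ℝ) (hc₀ : 0 < c₀) (hM : 0 < M) :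
    ∃ C : ℝ, 0 < C ∧
      ∀ (p q n L N m₁ m₂ : ℕ) (B κ Lk t δopt : ℝ)
        -- sizes of the sample, of the networks and of the Monte Carlo scheme
        (_ : 3 ≤ n) (_ : 3 ≤ L) (_ : p + q + 2 ≤ N) (_ : 1 ≤ m₁) (_ : 2 ≤ m₂)
        (_ : 0 < B) (_ : Real.log B ≤ c₁ * Real.log n)
        (_ : Real.log ((N : ℝ) * L) ≤ c₁ * Real.log n)
        (_ : 0 < κ) (_ : 0 < Lk) (_ : Lk ≤ ρ * κ ^ 2) (_ : 0 < t)
        -- the kernel and its reproducing kernel Hilbert space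
        (k : ℝ → ℝ → ℝ) (_ : Measurable (Function.uncurry k))
        (H : Type*) [NormedAddCommGroup H] [InnerProductSpace ℝ H] [CompleteSpace H]
        [RKHS ℝ H ℝ ℝ] (_ : HasKernel H k)
        (_ : ∀ y ∈ Set.Icc (-M) M, k y y ≤ κ ^ 2)
        (_ : ∀ y ∈ Set.Icc (-M) M, ∀ y' ∈ Set.Icc (-M) M,
          ‖featureMap H y - featureMap H y'‖ ^ 2 ≤ Lk * |y - y'|)
        -- the law of `(X, Y)` and the law of the noise
        (μ₀ : Measure ((Fin p → ℝ) × ℝ)) [IsProbabilityMeasure μ₀]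
        (_ : ∀ᵐ z ∂μ₀, (∀ j, z.1 j ∈ Set.Icc (-c₀) c₀) ∧ |z.2| ≤ M)
        (μᵤ : Measure (Fin q → ℝ)) [IsProbabilityMeasure μᵤ]
        (_ : ∀ᵐ u ∂μᵤ, ∀ j, u j ∈ Set.Icc (0 : ℝ) 1)
        -- the sample and the estimator
        (Ω : Type*) [MeasurableSpace Ω] (P : Measure Ω) [IsProbabilityMeasure P]
        (X : Fin n → Ω → Fin p → ℝ) (Y : Fin n → Ω → ℝ)
        (U : Fin m₁ → Fin n → Fin m₂ → Ω → Fin q → ℝ)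
        (_ : IsSample P μ₀ μᵤ X Y U)
        (ghat : Ω → (Fin p → ℝ) → (Fin q → ℝ) → ℝ)
        (_ : ∀ᵐ ω ∂P, ghat ω ∈ stochReLU p q L N M B ∧
          kernelLoss k (fun i => X i ω) (fun i => Y i ω) (fun b i r => U b i r ω) (ghat ω) ≤
            (⨅ g : stochReLU p q L N M B,
              kernelLoss k (fun i => X i ω) (fun i => Y i ω) (fun b i r => U b i r ω) g.1) + δopt),
        -- the inequality holds on an event of probability at least `1 - 4 e^{-t}`
        ∃ E : Set Ω, MeasurableSet E ∧ 1 - 4 * Real.exp (-t) ≤ P.real E ∧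
          ∀ ω ∈ E, embeddingError H μ₀ μᵤ (ghat ω) ≤
            C * ((⨅ g : stochReLU p q L N M B, embeddingError H μ₀ μᵤ g.1)
              + κ ^ 2 * statError N L n t ^ 2
              + κ ^ 2 * (statError N L n t / √((m₁ : ℝ) * m₂))
              + δopt) := by
  obtain ⟨A, hA, hnet⟩ := exists_finset_stochReLU c₀ c₁ (max ρ 1) (le_max_right _ _)
  refine ⟨18 + 128 * A + 4 * √(54 * A), by positivity, ?_⟩
  intro p q n L N m₁ m₂ B κ Lk t δopt hn hL hN hm₁ hm₂ hB hlB hlNL hκ hLk hLkρ ht k _ H _ _ _ _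
    hk hkκ hkL μ₀ _ hμ₀ μᵤ _ hμᵤ Ω _ P _ X Y U hS ghat hghat
  obtain ⟨T, hTsub, hTcard, hTnet⟩ := hnet p q n L N M B hn hL hN hM hB hlB hlNL
  have hn' : (3 : ℝ) ≤ n := by exact_mod_cast hn
  have hn0 : (0 : ℝ) < n := by linarith
  have hm₁' : (1 : ℝ) ≤ m₁ := by exact_mod_cast hm₁
  have hm₂' : (2 : ℝ) ≤ m₂ := by exact_mod_cast hm₂
  set Φ : ℝ → H := clampedFeatureMap H M with hΦdef
  have hΦ : Continuous Φ := continuous_clampedFeatureMap hM hkL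
  have hΦκ : ∀ y, ‖Φ y‖ ≤ κ := norm_clampedFeatureMap_le hk hM hκ.le hkκ
  have hcont : ∀ g ∈ stochReLU p q L N M B,
      Continuous fun z : (Fin p → ℝ) × (Fin q → ℝ) => g z.1 z.2 :=
    fun g hg => continuous_uncurry_of_mem_stochReLU hM hg
  have hrange : ∀ g ∈ stochReLU p q L N M B, ∀ x u, g x u ∈ Set.Icc (-M) M :=
    fun g hg => stochReLU_mem_Icc hM hg
  have herr : ∀ g ∈ stochReLU p q L N M B,
      embeddingError H μ₀ μᵤ g = sqError Φ μ₀ μᵤ g := fun g hg =>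
    embeddingError_eq_sqError (hμ₀.mono fun _ h => h.2) μᵤ (hrange g hg)
  obtain ⟨gz, hgz⟩ := stochReLU_nonempty p q L N M hB
  have : Nonempty (stochReLU p q L N M B) := ⟨⟨gz, hgz⟩⟩
  have hTne : T.Nonempty := by
    obtain ⟨g, hg, -⟩ := hTnet gz hgz
    exact ⟨g, hg⟩
  -- the net is `κ / n`-dense after embedding
  have hclose : ∀ g ∈ stochReLU p q L N M B, ∀ g' ∈ stochReLU p q L N M B, ∀ x u,
      |g x u - g' x u| ≤ 1 / (max ρ 1 * n ^ 2) → ‖Φ (g x u) - Φ (g' x u)‖ ≤ κ / n := by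
    intro g hg g' hg' x u h
    refine le_of_sq_le_sq ?_ (by positivity)
    rw [hΦdef, clampedFeatureMap_eq (hrange g hg x u), clampedFeatureMap_eq (hrange g' hg' x u)]
    refine (hkL _ (hrange g hg x u) _ (hrange g' hg' x u)).trans ?_
    have hρ : Lk ≤ max ρ 1 * κ ^ 2 :=
      hLkρ.trans (mul_le_mul_of_nonneg_right (le_max_left _ _) (sq_nonneg _))
    have hr : 0 < max ρ 1 := lt_of_lt_of_le one_pos (le_max_right _ _)
    calc Lk * |g x u - g' x u| ≤ max ρ 1 * κ ^ 2 * (1 / (max ρ 1 * n ^ 2)) := by gcongr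
      _ = (κ / n) ^ 2 := by field_simp
  -- a nearly optimal member of the class, independent of the sample
  have hpos : 0 < κ ^ 2 / n := by positivity
  obtain ⟨⟨g₀, hg₀⟩, hg₀inf⟩ := exists_lt_of_ciInf_lt (lt_add_of_pos_right
    (⨅ g : stochReLU p q L N M B, embeddingError H μ₀ μᵤ g.1) hpos)
  simp only [herr g₀ hg₀] at hg₀inf
  set s := t + Real.log T.card with hs
  obtain ⟨Bad, hBad, hgood⟩ := exists_event_deviation_le hΦ hΦκ hκ (by omega) hm₁ hm₂ hS hTne
    (fun g hg => hcont g (hTsub hg)) (hcont g₀ hg₀) ht.le hs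
  have hdata : ∀ᵐ ω ∂P, ∀ i, (∀ j, X i ω j ∈ Set.Icc (-c₀) c₀) ∧ |Y i ω| ≤ M :=
    ae_all_iff.2 fun i => by
      have := hμ₀
      rw [← (hS.law_data i).map_eq] at this
      exact ae_of_ae_map (hS.law_data i).aemeasurable this
  have hnoise : ∀ᵐ ω ∂P, ∀ b i r, ∀ j, U b i r ω j ∈ Set.Icc (0 : ℝ) 1 :=
    ae_all_iff.2 fun b => ae_all_iff.2 fun i => ae_all_iff.2 fun r => by
      have := hμᵤ
      rw [← (hS.law_noise b i r).map_eq] at this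
      exact ae_of_ae_map (hS.law_noise b i r).aemeasurable this
  have hall := (hdata.and hnoise).and hghat
  let Z : Set Ω := {ω | ¬ (((∀ i, (∀ j, X i ω j ∈ Set.Icc (-c₀) c₀) ∧ |Y i ω| ≤ M) ∧
    ∀ b i r, ∀ j, U b i r ω j ∈ Set.Icc (0 : ℝ) 1) ∧ ghat ω ∈ stochReLU p q L N M B ∧
      kernelLoss k (fun i => X i ω) (fun i => Y i ω) (fun b i r => U b i r ω) (ghat ω) ≤
        (⨅ g : stochReLU p q L N M B,
          kernelLoss k (fun i => X i ω) (fun i => Y i ω) (fun b i r => U b i r ω) g.1) + δopt)}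
  have hZ : P.real Z = 0 := by
    rw [measureReal_def, show P Z = 0 from hall, ENNReal.toReal_zero]
  -- `ghat` need not be measurable, hence the measurable hull of the exceptional set
  refine ⟨(toMeasurable P (Bad ∪ Z))ᶜ, (measurableSet_toMeasurable _ _).compl, ?_, ?_⟩
  · rw [probReal_compl_eq_one_sub (measurableSet_toMeasurable _ _), measureReal_def,
      measure_toMeasurable, ← measureReal_def]
    have := measureReal_union_le (μ := P) Bad Z
    linarith
  · intro ω hω
    have hω' : ω ∉ Bad ∪ Z := fun h => hω (subset_toMeasurable _ _ h)
    rw [Set.mem_union, not_or] at hω'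
    obtain ⟨hωB, hωZ⟩ := hω'
    obtain ⟨⟨hx, hu⟩, hgh, hopt⟩ := not_not.1 hωZ
    obtain ⟨hnetω, hg₀noise, hg₀data⟩ := hgood ω hωB
    have hloss : ∀ g ∈ stochReLU p q L N M B,
        kernelLoss k (fun i => X i ω) (fun i => Y i ω) (fun b i r => U b i r ω) g
          = kernelLoss (fun a b => inner ℝ (Φ a) (Φ b)) (fun i => X i ω) (fun i => Y i ω)
            (fun b i r => U b i r ω) g := fun g hg =>
      kernelLoss_eq_clamped hk (fun i => abs_le.1 (hx i).2) _ (hrange g hg)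
    have hbdd : BddBelow (Set.range fun g : stochReLU p q L N M B =>
        kernelLoss k (fun i => X i ω) (fun i => Y i ω) (fun b i r => U b i r ω) g.1) := by
      refine ⟨-(3 * κ ^ 2), ?_⟩
      rintro _ ⟨g, rfl⟩
      simp only [hloss g.1 g.2]
      exact (abs_le.1 (abs_kernelLoss_le hΦκ hm₂ _ _ _)).1
    have hinf₀ := ciInf_le hbdd ⟨g₀, hg₀⟩
    have hinfh := ciInf_le hbdd ⟨ghat ω, hgh⟩
    simp only [hloss g₀ hg₀] at hinf₀
    simp only [hloss _ hgh] at hinfh hopt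
    -- the optimization error is nonnegative, since the infimum is over a class containing `ghat ω`
    have hδ : 0 ≤ δopt := by linarith
    obtain ⟨g', hg', hnear⟩ := hTnet (ghat ω) hgh
    have hg'c := hTsub hg'
    obtain ⟨hdata', hnoise'⟩ := hnetω g' hg'
    have happrox : |kernelLoss (fun a b => inner ℝ (Φ a) (Φ b)) (fun i => X i ω) (fun i => Y i ω)
          (fun b i r => U b i r ω) (ghat ω)
        - kernelLoss (fun a b => inner ℝ (Φ a) (Φ b)) (fun i => X i ω) (fun i => Y i ω)
          (fun b i r => U b i r ω) g'| ≤ 4 * κ * (κ / n) :=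
      abs_kernelLoss_sub_le hΦκ hm₂ (by positivity) fun b i r =>
        hclose _ hgh _ hg'c _ _ (hnear _ _ (hx i).1 (hu b i r))
    have happrox' := (abs_le.1 happrox).1
    have herr' : sqError Φ μ₀ μᵤ (ghat ω) ≤ sqError Φ μ₀ μᵤ g' + 4 * κ * (κ / n) := by
      refine sqError_le_add hΦ hΦκ (hcont _ hgh) (hcont _ hg'c) (by positivity) ?_
      have hfst : ∀ᵐ x ∂μ₀.fst, ∀ j, x j ∈ Set.Icc (-c₀) c₀ := by
        have hms : MeasurableSet {x : Fin p → ℝ | ∀ j, x j ∈ Set.Icc (-c₀) c₀} := by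
          simp only [Set.ofPred_forall]
          exact MeasurableSet.iInter fun j => measurableSet_Icc.preimage (measurable_pi_apply j)
        exact (ae_map_iff measurable_fst.aemeasurable hms).2 (hμ₀.mono fun _ h => h.1)
      filter_upwards [hfst] with x hx
      filter_upwards [hμᵤ] with u hu
      exact hclose _ hgh _ hg'c _ _ (hnear _ _ hx hu)
    -- the remainder terms in the form of the statement
    set δ := statError N L n t with hδdef
    have hδ0 : 0 ≤ δ := by rw [hδdef, statError]; positivity
    have hsn : s / n ≤ A * δ ^ 2 := add_div_le_statError_sq hA hn ht hTcard
    have hn1 : 1 / (n : ℝ) ≤ δ ^ 2 := one_div_le_statError_sq (by omega) (by omega) hn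
    have r1 : κ * (κ / n) ≤ κ ^ 2 * δ ^ 2 := by
      calc κ * (κ / n) = κ ^ 2 * (1 / n) := by ring
        _ ≤ _ := by gcongr
    have r1' : κ ^ 2 / n ≤ κ ^ 2 * δ ^ 2 := by
      calc κ ^ 2 / n = κ * (κ / n) := by ring
        _ ≤ _ := r1
    have r2 : 32 * κ ^ 2 * s / n ≤ 32 * A * (κ ^ 2 * δ ^ 2) := by
      calc 32 * κ ^ 2 * s / n = 32 * κ ^ 2 * (s / n) := by ring
        _ ≤ 32 * κ ^ 2 * (A * δ ^ 2) := by gcongr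
        _ = _ := by ring
    have r3 : κ ^ 2 * √(54 * s / (n * (m₁ * m₂)))
        ≤ √(54 * A) * (κ ^ 2 * (δ / √((m₁ : ℝ) * m₂))) := by
      have e : √(54 * s / (n * (m₁ * m₂))) ≤ √(54 * A) * δ / √((m₁ : ℝ) * m₂) := by
        calc √(54 * s / (n * (m₁ * m₂))) = √(54 * (s / n) / (m₁ * m₂)) := by
              congr 1; field_simp
          _ ≤ √(54 * (A * δ ^ 2) / (m₁ * m₂)) := by gcongr
          _ = √(54 * A) * δ / √((m₁ : ℝ) * m₂) := by
              rw [Real.sqrt_div (by positivity), ← mul_assoc, Real.sqrt_mul (by positivity),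
                Real.sqrt_sq hδ0]
      calc _ ≤ κ ^ 2 * (√(54 * A) * δ / √((m₁ : ℝ) * m₂)) := by gcongr
        _ = _ := by ring
    have hinf0 : 0 ≤ ⨅ g : stochReLU p q L N M B, embeddingError H μ₀ μᵤ g.1 :=
      Real.iInf_nonneg fun g => integral_nonneg fun x => sq_nonneg _
    rw [herr _ hgh]
    set I := ⨅ g : stochReLU p q L N M B, embeddingError H μ₀ μᵤ g.1
    set V := κ ^ 2 * δ ^ 2
    set W := κ ^ 2 * (δ / √((m₁ : ℝ) * m₂))
    have hV : 0 ≤ V := by positivity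
    have hW : 0 ≤ W := by positivity
    have hR : 0 ≤ √(54 * A) := Real.sqrt_nonneg _
    -- chain: `ghat` to its neighbour `g'`, to its empirical risk, to its objective, back to the
    -- objective of `ghat`, to that of `g₀`, to the empirical risk of `g₀`, to its error
    have final : sqError Φ μ₀ μᵤ (ghat ω)
        ≤ 3 * I + (15 + 128 * A) * V + 4 * √(54 * A) * W + 2 * δopt := by linarith
    have hAV := mul_nonneg (by linarith : 0 ≤ A) hV
    have b1 : 0 ≤ (15 + 128 * A + 4 * √(54 * A)) * I := by positivity
    have b2 : 0 ≤ (3 + 4 * √(54 * A)) * V := by positivity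
    have b3 : 0 ≤ (18 + 128 * A) * W := by positivity
    have b4 : 0 ≤ (16 + 128 * A + 4 * √(54 * A)) * δopt := by positivity
    linarith
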